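/- **Setting.** Let $G$ be a finite-dimensional real Lie group with identity $e$ and Lie algebra $\mathfrak g=T_eG$ (bracket of left-invariant vector fields), and let $V$ be a finite-dimensional real vector space with a smooth left representation $(g,v)\mapsto g\cdot v$ and a smooth right representation $(v,g)\mapsto v\cdot g$ of $G$ that commute: $(g\cdot v)\cdot h=g\cdot(v\cdot h)$. The centered semi-direct product $G\Join V$ is the Lie group with underlying manifold $G\times V$ and multiplication $$(g,v)(h,w)=(gh,\; g\cdot w+v\cdot h).$$ For $\xi\in\mathfrak g$, $v\in V$ let $\xi\cdot v$ and $v\cdot\xi$ denote the infinitesimal actions, i.e. the derivatives at $e$ in the direction $\xi$ of $g\mapsto g\cdot v$ and $g\mapsto v\cdot g$. On $\mathfrak g\Join V:=\mathfrak g\times V$ put $$[(\xi_1,v_1),(\xi_2,v_2)]_{\Join}=\bigl([\xi_1,\xi_2],\;(\xi_1\cdot v_2+v_1\cdot\xi_2)-(\xi_2\cdot v_1+v_2\cdot\xi_1)\bigr).$$ For $\xi,\eta\in\mathfrak g$, $v\in V$, $\mu\in\mathfrak g^*$, $\alpha\in V^*$ define $\mathrm{ad}^*_\xi\mu\in\mathfrak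 g^*$, $\xi\heartsuit\alpha\in V^*$ and $v\diamondsuit\alpha\in\mathfrak g^*$ by $$\langle\mathrm{ad}^*_\xi\mu,\eta\rangle=\langle\mu,[\xi,\eta]\rangle,\qquad \langle\xi\heartsuit\alpha,v\rangle=\langle\alpha,\xi\cdot v-v\cdot\xi\rangle,\qquad \langle v\diamondsuit\alpha,\xi\rangle=\langle\alpha,v\cdot\xi-\xi\cdot v\rangle .$$ **Theorem.** Let $L:T(G\Join V)\to\mathbb R$ be a smooth Lagrangian that is invariant under right translations by $G\Join V$, and let $\ell:\mathfrak g\Join V\to\mathbb R$ be its restriction to the tangent space $\mathfrak g\times V$ at the identity $(e,0)$. Let $t_0<t_1$, let $c(t)=(g(t),v(t))$ be a curve in $G\Join V$ that is smooth on $[t_0,t_1]$ (that is, near every point of $[t_0,t_1]$), and let $\xi(t)=(\xi_g,\xi_v)(t):=(\dot g,\dot v)(t)\cdot(g,v)(t)^{-1}\in\mathfrak g\Join V$ be its right-trivialized velocity. Then the following four statements are equivalent. 1. (Hamilton's principle) For every smooth variation $c_\varepsilon$ of $c$ on $[t_0,t_1]$ with fixed endpoints, $\dfrac{d}{d\varepsilon}\Big|_{\varepsilon=0}\displaystyle\int_{t_0}^{t_1}L(c_\varepsilon(t),\dot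 c_\varepsilon(t))\,dt=0$. 2. (Euler–Lagrange equations) At every $t\in[t_0,t_1]$ and in every chart $q$ of $G\Join V$ around $c(t)$, $\dfrac{d}{dt}\dfrac{\partial L}{\partial\dot q}=\dfrac{\partial L}{\partial q}$ along $c$. 3. (Constrained reduced variational principle) For every smooth curve $\eta=(\eta_g,\eta_v)$ in $\mathfrak g\Join V$ on $[t_0,t_1]$ with $\eta(t_0)=\eta(t_1)=0$, and every smooth family $\xi_\varepsilon$ of curves in $\mathfrak g\Join V$ with $\xi_0=\xi$ whose variation $\delta\xi=\frac{d}{d\varepsilon}\big|_{\varepsilon=0}\xi_\varepsilon$ equals $$\delta\xi=\dot\eta-[\xi,\eta]_{\Join},$$ one has $\dfrac{d}{d\varepsilon}\Big|_{\varepsilon=0}\displaystyle\int_{t_0}^{t_1}\ell(\xi_\varepsilon(t))\,dt=0$. 4. (Euler–Poincaré equations) On $[t_0,t_1]$, along $\xi(t)$, $$\frac{d}{dt}\Bigl(\frac{\delta\ell}{\delta\xi_g}\Bigr)+\mathrm{ad}^*_{\xi_g}\Bigl(\frac{\delta\ell}{\delta\xi_g}\Bigr)+\xi_v\diamondsuit\frac{\delta\ell}{\delta\xi_v}=0,\qquad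 \frac{d}{dt}\Bigl(\frac{\delta\ell}{\delta\xi_v}\Bigr)+\xi_g\heartsuit\frac{\delta\ell}{\delta\xi_v}=0,$$ where $\delta\ell/\delta\xi_g\in\mathfrak g^*$ and $\delta\ell/\delta\xi_v\in V^*$ are the partial derivatives of $\ell$. -/

import Mathlib

open scoped Manifold ContDiff Topology MulOpposite
open Set

noncomputable section

/-! ### Lagrangian mechanics on a manifold -/

section Mechanics

variable {E : Type*} [NormedAddCommGroup E] [NormedSpace ℝ E]
  {H : Type*} [TopologicalSpace H] (I : ModelWithCorners ℝ E H)
  {M : Type*} [TopologicalSpace M] [ChartedSpace H M]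

/-- The velocity of a curve `c` at time `t`, a tangent vector at `c t`. -/
def velocity (c : ℝ → M) (t : ℝ) : TangentSpace I (c t) :=
  mfderiv 𝓘(ℝ, ℝ) I c t (1 : ℝ)

/-- The action `∫ L (c, ċ) dt` of a curve over `[t₀, t₁]`. -/
def action (L : TangentBundle I M → ℝ) (t₀ t₁ : ℝ) (c : ℝ → M) : ℝ :=
  ∫ t in t₀..t₁, L ⟨c t, velocity I c t⟩

/-- `γ` (with `γ ε` the curve at parameter `ε`) is a smooth variation of the curve `c` on
`[t₀, t₁]` with fixed endpoints. -/
structure IsFixedEndpointVariation (t₀ t₁ : ℝ) (c : ℝ → M) (γ : ℝ → ℝ → M) : Prop where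
  smooth : ∀ t ∈ Icc t₀ t₁, ContMDiffAt 𝓘(ℝ, ℝ × ℝ) I ∞ (fun p : ℝ × ℝ => γ p.1 p.2) (0, t)
  base : ∀ t ∈ Icc t₀ t₁, γ 0 t = c t
  left_fixed : ∀ᶠ ε in 𝓝 (0 : ℝ), γ ε t₀ = c t₀
  right_fixed : ∀ᶠ ε in 𝓝 (0 : ℝ), γ ε t₁ = c t₁

/-- Hamilton's principle: the action is stationary at `c` among all smooth variations of `c` with
fixed endpoints. -/
def HamiltonPrinciple (L : TangentBundle I M → ℝ) (t₀ t₁ : ℝ) (c : ℝ → M) : Prop :=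
  ∀ γ : ℝ → ℝ → M, IsFixedEndpointVariation I t₀ t₁ c γ →
    HasDerivAt (fun ε => action I L t₀ t₁ (γ ε)) 0 0

/-- The Lagrangian `L` in the local coordinates `(q, q̇)` given by a chart `e`. -/
def localLagrangian (L : TangentBundle I M → ℝ) (e : OpenPartialHomeomorph M H) (q w : E) : ℝ :=
  L ⟨(e.extend I).symm q, mfderiv 𝓘(ℝ, E) I (e.extend I).symm q w⟩

/-- The Euler–Lagrange equations `d/dt (∂L/∂q̇) = ∂L/∂q` at all times of `[t₀, t₁]`, in all charts
`e` of the smooth structure of `M` around the point of the curve, with `q` the coordinate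
expression of the curve. -/
def EulerLagrange (L : TangentBundle I M → ℝ) (t₀ t₁ : ℝ) (c : ℝ → M) : Prop :=
  ∀ t ∈ Icc t₀ t₁, ∀ e ∈ IsManifold.maximalAtlas I ∞ M, c t ∈ e.source →
    let q : ℝ → E := fun s => e.extend I (c s)
    HasDerivAt (fun s => fderiv ℝ (fun w => localLagrangian I L e (q s) w) (deriv q s))
      (fderiv ℝ (fun x => localLagrangian I L e x (deriv q t)) (q t)) t

end Mechanics

/-! ### Right trivialization and right-invariant Lagrangians on a Lie group -/

section RightInvariant

variable {E : Type*} [NormedAddCommGroup E] [NormedSpace ℝ E]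
  {H : Type*} [TopologicalSpace H] (I : ModelWithCorners ℝ E H)
  {K : Type*} [TopologicalSpace K] [ChartedSpace H K] [Group K]

/-- Right translation `w ↦ w · h` of tangent vectors, from `T_x K` to `T_{xh} K`. -/
def rightTranslate (h x : K) (w : TangentSpace I x) : TangentSpace I (x * h) :=
  mfderiv I I (fun y => y * h) x w

/-- Right-invariance `L ((x, w) · h) = L (x, w)` of a Lagrangian. -/
def RightInvariant (L : TangentBundle I K → ℝ) : Prop :=
  ∀ (h x : K) (w : TangentSpace I x), L ⟨x * h, rightTranslate I h x w⟩ = L ⟨x, w⟩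

/-- The right-trivialized velocity `ċ(t) · c(t)⁻¹`, in the tangent space at the identity. As
`c(t) c(t)⁻¹ = 1`, this is the tangent space at the identity; all tangent spaces of a manifold
modelled on `E` have `E` as underlying type, by means of the preferred chart at the point. -/
def rightTrivializedVelocity (c : ℝ → K) (t : ℝ) : E :=
  rightTranslate I (c t)⁻¹ (c t) (velocity I c t)

/-- The reduced Lagrangian: the restriction of `L` to the tangent space at the identity. -/
def reducedLagrangian (L : TangentBundle I K → ℝ) (ξ : E) : ℝ :=
  L ⟨1, ξ⟩

end RightInvariant

/-! ### Commuting representations and the centered semi-direct product -/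

/-- A pair of commuting smooth representations of a Lie group `G`, one from the left and one from
the right, on `V`. A right representation is a representation of the opposite group. -/
structure CommutingReps (E G V : Type*) [NormedAddCommGroup E] [NormedSpace ℝ E]
    [TopologicalSpace G] [ChartedSpace E G] [Group G]
    [NormedAddCommGroup V] [NormedSpace ℝ V] where
  left : Representation ℝ G V
  right : Representation ℝ Gᵐᵒᵖ V
  commute : ∀ (g h : G) (v : V), right (.op h) (left g v) = left g (right (.op h) v)
  smooth_left : ContMDiff (𝓘(ℝ, E).prod 𝓘(ℝ, V)) 𝓘(ℝ, V) ∞ (fun p : G × V => left p.1 p.2)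
  smooth_right : ContMDiff (𝓘(ℝ, E).prod 𝓘(ℝ, V)) 𝓘(ℝ, V) ∞
    (fun p : G × V => right (.op p.1) p.2)

section Bowtie

variable {E G V : Type*} [NormedAddCommGroup E] [NormedSpace ℝ E]
  [TopologicalSpace G] [ChartedSpace E G] [Group G]
  [NormedAddCommGroup V] [NormedSpace ℝ V]

/-- The centered semi-direct product `G ⋈ V`, with underlying manifold `G × V`. -/
def Bowtie (_A : CommutingReps E G V) : Type _ := G × V

namespace Bowtie

variable (A : CommutingReps E G V)

instance : TopologicalSpace (Bowtie A) := inferInstanceAs (TopologicalSpace (G × V))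

instance : ChartedSpace (ModelProd E V) (Bowtie A) :=
  inferInstanceAs (ChartedSpace (ModelProd E V) (G × V))

/-- The group law `(g, v) (h, w) = (g h, g · w + v · h)`. -/
instance : Group (Bowtie A) where
  mul x y := (x.1 * y.1, A.left x.1 y.2 + A.right (.op y.1) x.2)
  one := ((1 : G), (0 : V))
  inv x := (x.1⁻¹, -A.right (.op x.1⁻¹) (A.left x.1⁻¹ x.2))
  mul_assoc x y z := by
    refine Prod.ext (mul_assoc x.1 y.1 z.1) ?_
    change A.left (x.1 * y.1) z.2 + A.right (.op z.1) (A.left x.1 y.2 + A.right (.op y.1) x.2)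
      = A.left x.1 (A.left y.1 z.2 + A.right (.op z.1) y.2) + A.right (.op (y.1 * z.1)) x.2
    simp [A.commute, add_assoc]
  one_mul x := by
    refine Prod.ext (one_mul x.1) ?_
    change A.left 1 x.2 + A.right (.op x.1) 0 = x.2
    simp
  mul_one x := by
    refine Prod.ext (mul_one x.1) ?_
    change A.left x.1 0 + A.right (.op 1) x.2 = x.2
    simp
  inv_mul_cancel x := by
    refine Prod.ext (inv_mul_cancel x.1) ?_
    change A.left x.1⁻¹ x.2 + A.right (.op x.1) (-A.right (.op x.1⁻¹) (A.left x.1⁻¹ x.2)) = 0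
    rw [map_neg, ← Module.End.mul_apply, ← map_mul, ← MulOpposite.op_mul]
    simp

instance [LieGroup 𝓘(ℝ, E) ∞ G] : LieGroup (𝓘(ℝ, E).prod 𝓘(ℝ, V)) ∞ (Bowtie A) := by
  have hG : IsManifold 𝓘(ℝ, E) ∞ G := inferInstance
  have hM : IsManifold (𝓘(ℝ, E).prod 𝓘(ℝ, V)) ∞ (G × V) := inferInstance
  have f1 : ContMDiff (𝓘(ℝ, E).prod 𝓘(ℝ, V)) 𝓘(ℝ, E) ∞ (fun x : G × V => x.1) := contMDiff_fst
  have f2 : ContMDiff (𝓘(ℝ, E).prod 𝓘(ℝ, V)) 𝓘(ℝ, V) ∞ (fun x : G × V => x.2) := contMDiff_snd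
  refine @LieGroup.mk _ _ _ _ _ _ _ _ _ _ _ _ _ (@ContMDiffMul.mk _ _ _ _ _ _ _ _ _ _ _ _ _ hM ?_) ?_
  · change ContMDiff ((𝓘(ℝ, E).prod 𝓘(ℝ, V)).prod (𝓘(ℝ, E).prod 𝓘(ℝ, V)))
      (𝓘(ℝ, E).prod 𝓘(ℝ, V)) ∞ (fun p : (G × V) × (G × V) =>
        ((p.1.1 * p.2.1, A.left p.1.1 p.2.2 + A.right (.op p.2.1) p.1.2) : G × V))
    have p1 := f1.comp (contMDiff_fst (M := G × V) (N := G × V) (I := 𝓘(ℝ, E).prod 𝓘(ℝ, V))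
      (J := 𝓘(ℝ, E).prod 𝓘(ℝ, V)) (n := ∞))
    have p2 := f1.comp (contMDiff_snd (M := G × V) (N := G × V) (I := 𝓘(ℝ, E).prod 𝓘(ℝ, V))
      (J := 𝓘(ℝ, E).prod 𝓘(ℝ, V)) (n := ∞))
    have q1 := f2.comp (contMDiff_fst (M := G × V) (N := G × V) (I := 𝓘(ℝ, E).prod 𝓘(ℝ, V))
      (J := 𝓘(ℝ, E).prod 𝓘(ℝ, V)) (n := ∞))
    have q2 := f2.comp (contMDiff_snd (M := G × V) (N := G × V) (I := 𝓘(ℝ, E).prod 𝓘(ℝ, V))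
      (J := 𝓘(ℝ, E).prod 𝓘(ℝ, V)) (n := ∞))
    exact (p1.mul p2).prodMk
      ((A.smooth_left.comp (p1.prodMk q2)).add (A.smooth_right.comp (p2.prodMk q1)))
  · change ContMDiff (𝓘(ℝ, E).prod 𝓘(ℝ, V)) (𝓘(ℝ, E).prod 𝓘(ℝ, V)) ∞ (fun x : G × V =>
        ((x.1⁻¹, -A.right (.op x.1⁻¹) (A.left x.1⁻¹ x.2)) : G × V))
    have i := f1.inv
    exact i.prodMk ((A.smooth_right.comp (i.prodMk (A.smooth_left.comp (i.prodMk f2)))).neg)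

end Bowtie

/-! ### Infinitesimal actions, bracket, coadjoint, heart and diamond operators

Elements of `𝔤 = T_e G` are written as elements of `E`, the underlying type of that tangent space,
and elements of `𝔤 ⋈ V` as elements of `E × V`. -/

variable (A : CommutingReps E G V)

lemma CommutingReps.mdifferentiableAt_left (v : V) :
    MDifferentiableAt 𝓘(ℝ, E) 𝓘(ℝ, V) (fun g : G => A.left g v) 1 :=
  ((A.smooth_left.comp
    ((contMDiff_id (I := 𝓘(ℝ, E))).prodMk (contMDiff_const (c := v)))).mdifferentiable (by simp)) 1

lemma CommutingReps.mdifferentiableAt_right (v : V) :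
    MDifferentiableAt 𝓘(ℝ, E) 𝓘(ℝ, V) (fun g : G => A.right (.op g) v) 1 :=
  ((A.smooth_right.comp
    ((contMDiff_id (I := 𝓘(ℝ, E))).prodMk (contMDiff_const (c := v)))).mdifferentiable (by simp)) 1

/-- `ξ ↦ ξ · v`, the infinitesimal left action on `v`: the derivative at the identity of
`g ↦ g · v` in the direction `ξ`. -/
def CommutingReps.infLeft (v : V) : E →L[ℝ] V :=
  mfderiv 𝓘(ℝ, E) 𝓘(ℝ, V) (fun g : G => A.left g v) (1 : G)

/-- `ξ ↦ v · ξ`, the infinitesimal right action on `v`: the derivative at the identity of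
`g ↦ v · g` in the direction `ξ`. -/
def CommutingReps.infRight (v : V) : E →L[ℝ] V :=
  mfderiv 𝓘(ℝ, E) 𝓘(ℝ, V) (fun g : G => A.right (.op g) v) (1 : G)

lemma CommutingReps.infLeft_add (v w : V) : A.infLeft (v + w) = A.infLeft v + A.infLeft w := by
  have h : (fun g : G => A.left g (v + w)) = (fun g => A.left g v) + fun g => A.left g w := by
    ext g; simp
  unfold CommutingReps.infLeft
  rw [h]
  exact mfderiv_add (A.mdifferentiableAt_left v) (A.mdifferentiableAt_left w)

lemma CommutingReps.infRight_add (v w : V) :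
    A.infRight (v + w) = A.infRight v + A.infRight w := by
  have h : (fun g : G => A.right (.op g) (v + w)) =
      (fun g => A.right (.op g) v) + fun g => A.right (.op g) w := by
    ext g; simp
  unfold CommutingReps.infRight
  rw [h]
  exact mfderiv_add (A.mdifferentiableAt_right v) (A.mdifferentiableAt_right w)

lemma CommutingReps.infLeft_smul (r : ℝ) (v : V) : A.infLeft (r • v) = r • A.infLeft v := by
  have h : (fun g : G => A.left g (r • v)) = r • (fun g => A.left g v) := by
    ext g; simp
  unfold CommutingReps.infLeft
  rw [h]
  exact const_smul_mfderiv (A.mdifferentiableAt_left v) r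

lemma CommutingReps.infRight_smul (r : ℝ) (v : V) : A.infRight (r • v) = r • A.infRight v := by
  have h : (fun g : G => A.right (.op g) (r • v)) = r • (fun g => A.right (.op g) v) := by
    ext g; simp
  unfold CommutingReps.infRight
  rw [h]
  exact const_smul_mfderiv (A.mdifferentiableAt_right v) r

/-- The linear map `v ↦ ξ · v - v · ξ`. -/
def CommutingReps.infDiff (ξ : E) : V →ₗ[ℝ] V where
  toFun v := A.infLeft v ξ - A.infRight v ξ
  map_add' v w := by
    simp only [A.infLeft_add, A.infRight_add, add_apply]; abel
  map_smul' r v := by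
    simp [A.infLeft_smul, A.infRight_smul, smul_sub]

/-- The heart operator `ξ ♥ α ∈ V*`, `⟨ξ ♥ α, v⟩ = ⟨α, ξ · v - v · ξ⟩`. -/
def CommutingReps.heart [FiniteDimensional ℝ V] (ξ : E) (α : V →L[ℝ] ℝ) : V →L[ℝ] ℝ :=
  α.comp (LinearMap.toContinuousLinearMap (A.infDiff ξ))

/-- The diamond operator `v ◇ α ∈ 𝔤*`, `⟨v ◇ α, ξ⟩ = ⟨α, v · ξ - ξ · v⟩`. -/
def CommutingReps.diamond (v : V) (α : V →L[ℝ] ℝ) : E →L[ℝ] ℝ :=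
  α.comp (A.infRight v - A.infLeft v)

variable (G) in
/-- The bracket of the Lie algebra `𝔤` of `G` (that of left-invariant vector fields). -/
def lieBr (ξ η : E) : E :=
  (⁅(show GroupLieAlgebra 𝓘(ℝ, E) G from ξ), (show GroupLieAlgebra 𝓘(ℝ, E) G from η)⁆ :
    GroupLieAlgebra 𝓘(ℝ, E) G)

variable (G) in
/-- `ad_ξ : 𝔤 → 𝔤`, `η ↦ [ξ, η]`, as a linear map. -/
def adMap [FiniteDimensional ℝ E] [LieGroup 𝓘(ℝ, E) ∞ G] (ξ : E) : E →ₗ[ℝ] E :=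
  haveI : CompleteSpace E := FiniteDimensional.complete ℝ E
  haveI : LieGroup 𝓘(ℝ, E) (minSmoothness ℝ 3) G :=
    LieGroup.of_le (n := ∞) (by
      rw [minSmoothness_of_isRCLikeNormedField]; exact ENat.LEInfty.out)
  { toFun := lieBr G ξ
    map_add' := fun η ζ => lie_add (show GroupLieAlgebra 𝓘(ℝ, E) G from ξ)
      (show GroupLieAlgebra 𝓘(ℝ, E) G from η) (show GroupLieAlgebra 𝓘(ℝ, E) G from ζ)
    map_smul' := fun r η => lie_smul r (show GroupLieAlgebra 𝓘(ℝ, E) G from ξ)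
      (show GroupLieAlgebra 𝓘(ℝ, E) G from η) }

variable (G) in
/-- The coadjoint operator `ad*_ξ μ ∈ 𝔤*`, `⟨ad*_ξ μ, η⟩ = ⟨μ, [ξ, η]⟩`. -/
def coad [FiniteDimensional ℝ E] [LieGroup 𝓘(ℝ, E) ∞ G] (ξ : E) (μ : E →L[ℝ] ℝ) : E →L[ℝ] ℝ :=
  μ.comp (LinearMap.toContinuousLinearMap (adMap G ξ))

/-- The bracket of `𝔤 ⋈ V`:
`[(ξ, v), (η, w)]_⋈ = ([ξ, η], (ξ · w + v · η) - (η · v + w · ξ))`. -/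
def CommutingReps.bowtieBracket (x y : E × V) : E × V :=
  (lieBr G x.1 y.1,
    (A.infLeft y.2 x.1 + A.infRight x.2 y.1) - (A.infLeft x.2 y.1 + A.infRight y.2 x.1))

/-! ### The reduced variational principle and the Euler–Poincaré equations -/

/-- The constrained variational principle `δ ∫ ℓ(ξ) dt = 0` at `ξ` on `[t₀, t₁]`: for every smooth
curve `η` in `𝔤 ⋈ V` that vanishes at the endpoints, the integral is stationary along every smooth
family `Ξ ε` of curves with `Ξ 0 = ξ` whose variation is `δξ = η̇ - [ξ, η]_⋈`. -/
def CommutingReps.ReducedVariationalPrinciple (ℓ : E × V → ℝ) (t₀ t₁ : ℝ) (ξ : ℝ → E × V) :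
    Prop :=
  ∀ (η : ℝ → E × V) (Ξ : ℝ → ℝ → E × V),
    (∀ t ∈ Icc t₀ t₁, ContDiffAt ℝ ∞ η t) → η t₀ = 0 → η t₁ = 0 →
    (∀ t ∈ Icc t₀ t₁, ContDiffAt ℝ ∞ (fun p : ℝ × ℝ => Ξ p.1 p.2) (0, t)) →
    (∀ t ∈ Icc t₀ t₁, Ξ 0 t = ξ t) →
    (∀ t ∈ Icc t₀ t₁,
      HasDerivAt (fun ε => Ξ ε t) (deriv η t - A.bowtieBracket (ξ t) (η t)) 0) →
    HasDerivAt (fun ε => ∫ t in t₀..t₁, ℓ (Ξ ε t)) 0 0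

/-- `δℓ/δξ_g ∈ 𝔤*` at `x = (ξ_g, ξ_v)`. -/
def partialG (ℓ : E × V → ℝ) (x : E × V) : E →L[ℝ] ℝ :=
  fderiv ℝ (fun ζ : E => ℓ (ζ, x.2)) x.1

/-- `δℓ/δξ_v ∈ V*` at `x = (ξ_g, ξ_v)`. -/
def partialV (ℓ : E × V → ℝ) (x : E × V) : V →L[ℝ] ℝ :=
  fderiv ℝ (fun w : V => ℓ (x.1, w)) x.2

/-- The centered semi-direct Euler–Poincaré equations on `[t₀, t₁]`; that the momenta are
differentiable in time is part of the statement. -/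
def CommutingReps.EulerPoincare [FiniteDimensional ℝ E] [FiniteDimensional ℝ V]
    [LieGroup 𝓘(ℝ, E) ∞ G] (ℓ : E × V → ℝ) (t₀ t₁ : ℝ) (ξ : ℝ → E × V) : Prop :=
  ∀ t ∈ Icc t₀ t₁,
    DifferentiableAt ℝ (fun s => partialG ℓ (ξ s)) t ∧
    DifferentiableAt ℝ (fun s => partialV ℓ (ξ s)) t ∧
    deriv (fun s => partialG ℓ (ξ s)) t + coad G (ξ t).1 (partialG ℓ (ξ t))
      + A.diamond (ξ t).2 (partialV ℓ (ξ t)) = 0 ∧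
    deriv (fun s => partialV ℓ (ξ s)) t + A.heart (ξ t).1 (partialV ℓ (ξ t)) = 0

end Bowtie

end

open scoped Manifold ContDiff Topology MulOpposite
open Set

noncomputable section

/-! ### Second derivatives -/

section SecondDerivative

variable {X Y Z : Type*} [NormedAddCommGroup X] [NormedSpace ℝ X]
  [NormedAddCommGroup Y] [NormedSpace ℝ Y] [NormedAddCommGroup Z] [NormedSpace ℝ Z]

/-! Everything is compared with one covector, the Euler–Poincaré expression `eulerPoincareForm`:
`d/dt (δℓ/δξ) + ad*_ξ (δℓ/δξ)` on the Lie algebra of the whole group `K = G ⋈ V`. The argument works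
on any boundaryless Lie group `K`; the semi-direct structure enters only when the bracket is
computed.

In a chart, let `R_q` (`chartTriv`) be the right trivialization. A right-invariant Lagrangian reads
`ℓ(R_q q̇)` (`localLagrangian_eq`). The identity `(x y⁻¹)(y z⁻¹) = x z⁻¹`, differentiated once in
`x` and once in `y`, yields the Maurer–Cartan equation `dR(u) w - dR(w) u = B(R u, R w)`
(`fderiv_chartTriv_sub`), where `B` is the antisymmetrized mixed second derivative of the
multiplication at the identity. Both reductions rest on it.

Variational side: for a two-parameter family with right-trivialized velocities `ξ` in time and `η`
in the parameter, Maurer–Cartan gives `δξ = η̇ - B(ξ, η)` (`rightTrivializedVelocity_variation`).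
Integration by parts then makes the first variation of the reduced action equal to minus the
integral of the Euler–Poincaré covector paired with `η`
(`IsConstrainedVariation.hasDerivAt_integral`). It depends on `η` alone, and every admissible `η`
comes from a variation of `c` (`exists_isFixedEndpointVariation`), so 1 and 3 agree; the fundamental
lemma gives 3 ⇔ 4.

Differential side: by Maurer–Cartan, the defect of the Euler–Lagrange equation in a chart is the
Euler–Poincaré covector composed with `R_q`. Surjectivity of `R_q` gives 2 ⇔ 4.

Finally, `B` is the bracket of left-invariant fields (`mlieBracket_mulInvariantVectorField`), and on
`G ⋈ V` it is the bracket of `𝔤 ⋈ V` (`CommutingReps.mulBracket_bowtie`); splitting the covector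
into components produces the coadjoint, diamond and heart terms. -/

lemma ContDiffAt.differentiableAt_fderiv {f : X → Y} {x : X} (hf : ContDiffAt ℝ 2 f x) :
    DifferentiableAt ℝ (fderiv ℝ f) x :=
  (hf.fderiv_right (m := 1) (by norm_num)).differentiableAt (by simp)

lemma ContDiffAt.eventually_differentiableAt {f : X → Y} {x : X} (hf : ContDiffAt ℝ 2 f x) :
    ∀ᶠ y in 𝓝 x, DifferentiableAt ℝ f y :=
  (hf.eventually (by simp)).mono fun _ hy => hy.differentiableAt (by simp)

lemma ContDiffAt.fderiv_fderiv_symm {f : X → Y} {x : X} (hf : ContDiffAt ℝ 2 f x) (u w : X) :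
    fderiv ℝ (fderiv ℝ f) x u w = fderiv ℝ (fderiv ℝ f) x w u :=
  (hf.isSymmSndFDerivAt (by simp)).eq u w

/-- The chain rule for second derivatives. -/
lemma fderiv_fderiv_comp {g : Y → Z} {f : X → Y} {x : X} (hg : ContDiffAt ℝ 2 g (f x))
    (hf : ContDiffAt ℝ 2 f x) (u w : X) :
    fderiv ℝ (fderiv ℝ (fun y => g (f y))) x u w =
      fderiv ℝ (fderiv ℝ g) (f x) (fderiv ℝ f x u) (fderiv ℝ f x w) +
        fderiv ℝ g (f x) (fderiv ℝ (fderiv ℝ f) x u w) := by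
  have hev : fderiv ℝ (fun y => g (f y)) =ᶠ[𝓝 x]
      fun y => (fderiv ℝ g (f y)).comp (fderiv ℝ f y) := by
    filter_upwards [hf.continuousAt.eventually hg.eventually_differentiableAt,
      hf.eventually_differentiableAt] with y h1 h2
    exact fderiv_comp y h1 h2
  rw [hev.fderiv_eq]
  have h1 : HasFDerivAt (fun y => fderiv ℝ g (f y))
      ((fderiv ℝ (fderiv ℝ g) (f x)).comp (fderiv ℝ f x)) x :=
    hg.differentiableAt_fderiv.hasFDerivAt.comp x (hf.differentiableAt (by simp)).hasFDerivAt
  rw [(h1.clm_comp hf.differentiableAt_fderiv.hasFDerivAt).fderiv]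
  simp [add_comm]

lemma fderiv_fderiv_clm (l : X →L[ℝ] Y) (x : X) : fderiv ℝ (fderiv ℝ l) x = 0 := by
  have : fderiv ℝ (l : X → Y) = fun _ => l := funext fun y => l.fderiv
  rw [this]; simp

lemma fderiv_fderiv_comp_clm {g : Y → Z} (l : X →L[ℝ] Y) {x : X} (hg : ContDiffAt ℝ 2 g (l x))
    (u w : X) :
    fderiv ℝ (fderiv ℝ (fun y => g (l y))) x u w =
      fderiv ℝ (fderiv ℝ g) (l x) (l u) (l w) := by
  rw [fderiv_fderiv_comp hg l.contDiff.contDiffAt, fderiv_fderiv_clm]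
  simp

lemma fderiv_fderiv_clm_comp (l : Y →L[ℝ] Z) {f : X → Y} {x : X} (hf : ContDiffAt ℝ 2 f x)
    (u w : X) :
    fderiv ℝ (fderiv ℝ (fun y => l (f y))) x u w = l (fderiv ℝ (fderiv ℝ f) x u w) := by
  rw [fderiv_fderiv_comp l.contDiff.contDiffAt hf, fderiv_fderiv_clm]
  simp

/-- A second derivative as an iterated directional derivative. -/
lemma fderiv_fderiv_eq_deriv_deriv {f : X → Y} {x : X} (hf : ContDiffAt ℝ 2 f x) (u w : X) :
    fderiv ℝ (fderiv ℝ f) x u w =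
      deriv (fun s : ℝ => deriv (fun r : ℝ => f (x + s • u + r • w)) 0) 0 := by
  have hline : ∀ (y v : X), HasDerivAt (fun s : ℝ => y + s • v) v 0 := fun y v => by
    simpa using ((hasDerivAt_id (0 : ℝ)).smul_const v).const_add y
  have hcont : Filter.Tendsto (fun s : ℝ => x + s • u) (𝓝 0) (𝓝 x) := by
    simpa using (hline x u).continuousAt.tendsto
  have hev : (fun s : ℝ => deriv (fun r : ℝ => f (x + s • u + r • w)) 0) =ᶠ[𝓝 0]
      fun s => fderiv ℝ f (x + s • u) w := by
    filter_upwards [hcont.eventually hf.eventually_differentiableAt] with s hs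
    exact (hs.hasFDerivAt.comp_hasDerivAt_of_eq (0 : ℝ) (hline _ w) (by simp)).deriv
  rw [hev.deriv_eq]
  have h2 := (hf.differentiableAt_fderiv.hasFDerivAt.comp_hasDerivAt_of_eq (0 : ℝ) (hline x u)
    (by simp)).clm_apply (hasDerivAt_const (0 : ℝ) w)
  rw [map_zero, add_zero] at h2
  exact h2.deriv.symm

end SecondDerivative

/-! ### Integrals depending on a parameter, and the fundamental lemma -/

section Integrals

/-- Differentiation under the integral sign, for integrands that are `C²` near the slice. -/
lemma hasDerivAt_integral_of_contDiffAt {F : ℝ × ℝ → ℝ} {t₀ t₁ : ℝ} (ht : t₀ ≤ t₁)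
    (hF : ∀ t ∈ Icc t₀ t₁, ContDiffAt ℝ 2 F (0, t)) :
    HasDerivAt (fun ε => ∫ t in t₀..t₁, F (ε, t)) (∫ t in t₀..t₁, fderiv ℝ F (0, t) (1, 0)) 0 := by
  have hU : ∀ᶠ p in 𝓝ˢ (({0} : Set ℝ) ×ˢ Icc t₀ t₁), ContDiffAt ℝ 2 F p := by
    rw [Filter.eventually_iff, mem_nhdsSet_iff_forall]
    rintro ⟨x, t⟩ ⟨rfl, h⟩
    exact (hF t h).eventually (by simp)
  -- Tube lemma: the neighbourhood of the compact slice contains a product. A closed ball in the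
  -- parameter keeps the region compact, so a constant dominates the derivative.
  rw [isCompact_singleton.nhdsSet_prod_eq isCompact_Icc, nhdsSet_singleton] at hU
  obtain ⟨U, hU0, W, hW, hUW⟩ := Filter.mem_prod_iff.1 hU
  obtain ⟨δ, hδ, hball⟩ := Metric.nhds_basis_closedBall.mem_iff.1 hU0
  have hW' : Icc t₀ t₁ ⊆ W := subset_of_mem_nhdsSet hW
  have hsm : ∀ x ∈ Metric.closedBall (0 : ℝ) δ, ∀ t ∈ Icc t₀ t₁, ContDiffAt ℝ 2 F (x, t) :=
    fun x hx t h => hUW ⟨hball hx, hW' h⟩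
  have hpair : ∀ x t : ℝ, ContinuousAt (fun t : ℝ => (x, t)) t := fun x t => by fun_prop
  have hcF : ∀ x ∈ Metric.closedBall (0 : ℝ) δ, ContinuousOn (fun t => F (x, t)) (Icc t₀ t₁) :=
    fun x hx t h => (ContinuousAt.comp (g := F) (f := fun t : ℝ => (x, t))
      (hsm x hx t h).continuousAt (hpair x t)).continuousWithinAt
  have hcD : ContinuousOn (fun p : ℝ × ℝ => fderiv ℝ F p (1, 0))
      (Metric.closedBall (0 : ℝ) δ ×ˢ Icc t₀ t₁) := fun p hp =>
    ((hsm p.1 hp.1 p.2 hp.2).differentiableAt_fderiv.continuousAt.clm_apply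
      continuousAt_const).continuousWithinAt
  obtain ⟨C, hC⟩ := ((isCompact_closedBall (0 : ℝ) δ).prod isCompact_Icc).exists_bound_of_continuousOn
    hcD
  have h0 : (0 : ℝ) ∈ Metric.closedBall (0 : ℝ) δ := Metric.mem_closedBall_self hδ.le
  have hI : uIoc t₀ t₁ ⊆ Icc t₀ t₁ := by
    rw [uIoc_of_le ht]; exact Ioc_subset_Icc_self
  have hae : ∀ {f : ℝ → ℝ}, ContinuousOn f (Icc t₀ t₁) →
      MeasureTheory.AEStronglyMeasurable f (MeasureTheory.volume.restrict (uIoc t₀ t₁)) :=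
    fun h => (h.mono hI).aestronglyMeasurable measurableSet_uIoc
  refine (intervalIntegral.hasDerivAt_integral_of_dominated_loc_of_deriv_le
    (F' := fun x t => fderiv ℝ F (x, t) (1, 0)) (bound := fun _ => C)
    (Metric.closedBall_mem_nhds (0 : ℝ) hδ) ?_ ?_ ?_ ?_ ?_ ?_).2
  · filter_upwards [Metric.closedBall_mem_nhds (0 : ℝ) hδ] with x hx using hae (hcF x hx)
  · exact (hcF 0 h0).intervalIntegrable_of_Icc ht
  · refine hae fun t h => ?_
    exact (hcD (0, t) ⟨h0, h⟩).comp (t := Metric.closedBall (0 : ℝ) δ ×ˢ Icc t₀ t₁)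
      (f := fun t : ℝ => ((0 : ℝ), t)) (hpair 0 t).continuousWithinAt fun s hs => ⟨h0, hs⟩
  · exact Filter.Eventually.of_forall fun t h x hx => hC (x, t) ⟨hx, hI h⟩
  · exact intervalIntegrable_const
  · refine Filter.Eventually.of_forall fun t h x hx => ?_
    have h1 := ((hsm x hx t (hI h)).differentiableAt (by simp)).hasFDerivAt
    exact h1.comp_hasDerivAt x (f := fun x : ℝ => (x, t))
      ((hasDerivAt_id x).prodMk (hasDerivAt_const x t))

/-- The fundamental lemma of the calculus of variations on a compact interval. -/
lemma eq_zero_of_integral_contDiff_mul_eq_zero {f : ℝ → ℝ} {t₀ t₁ : ℝ} (ht : t₀ < t₁)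
    (hf : ContinuousOn f (Icc t₀ t₁))
    (h : ∀ χ : ℝ → ℝ, ContDiff ℝ ∞ χ → χ t₀ = 0 → χ t₁ = 0 → ∫ t in t₀..t₁, χ t * f t = 0) :
    ∀ t ∈ Icc t₀ t₁, f t = 0 := by
  have hloc : MeasureTheory.LocallyIntegrableOn f (Ioo t₀ t₁) MeasureTheory.volume :=
    (hf.mono Ioo_subset_Icc_self).locallyIntegrableOn measurableSet_Ioo
  -- Bump functions supported in the open interval vanish at both endpoints, so the hypothesis
  -- applies to them.
  have hae := isOpen_Ioo.ae_eq_zero_of_integral_contDiff_smul_eq_zero hloc fun χ hχ _ hsupp => by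
    have hz : ∀ t ∉ Ioo t₀ t₁, χ t = 0 := fun t h => image_eq_zero_of_notMem_tsupport
      fun h' => h (hsupp h')
    have h1 := h χ hχ (hz t₀ (by simp)) (hz t₁ (by simp))
    rw [intervalIntegral.integral_of_le ht.le] at h1
    rw [← h1]
    refine (MeasureTheory.setIntegral_eq_integral_of_forall_compl_eq_zero fun t h => ?_).symm
    rw [hz t fun h' => h (Ioo_subset_Ioc_self h'), zero_smul]
  have hIoo : EqOn f (fun _ => 0) (Ioo t₀ t₁) := by
    refine MeasureTheory.Measure.eqOn_open_of_ae_eq (μ := MeasureTheory.volume) ?_ isOpen_Ioo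
      (hf.mono Ioo_subset_Icc_self) continuousOn_const
    rw [Filter.EventuallyEq, MeasureTheory.ae_restrict_iff' measurableSet_Ioo]
    exact hae
  -- Continuity up to the boundary recovers the endpoints.
  have := hIoo.of_subset_closure hf continuousOn_const Ioo_subset_Icc_self
    (by rw [closure_Ioo ht.ne])
  exact this

end Integrals

/-! ### Right trivialization in charts -/

section Charts

variable {F : Type*} [NormedAddCommGroup F] [NormedSpace ℝ F]
  {H : Type*} [TopologicalSpace H] (I : ModelWithCorners ℝ F H)
  {M : Type*} [TopologicalSpace M] [ChartedSpace H M]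

/-- Without boundary the target of an extended chart is open, so smoothness on it is smoothness at
each of its points. -/
lemma contMDiffAt_extend_symm [I.Boundaryless] {e : OpenPartialHomeomorph M H}
    (he : e ∈ IsManifold.maximalAtlas I ∞ M) {q : F} (hq : q ∈ (e.extend I).target) :
    ContMDiffAt 𝓘(ℝ, F) I ∞ (e.extend I).symm q := by
  have h := contMDiffOn_extend_symm he
  rw [← e.extend_target'] at h
  exact h.contMDiffAt (e.isOpen_extend_target.mem_nhds hq)

end Charts

section RightTrivialization

variable {F : Type*} [NormedAddCommGroup F] [NormedSpace ℝ F]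
  {H : Type*} [TopologicalSpace H] (I : ModelWithCorners ℝ F H)
  {K : Type*} [TopologicalSpace K] [ChartedSpace H K] [Group K]
  {X : Type*} [NormedAddCommGroup X] [NormedSpace ℝ X]

/-- A right-invariant Lagrangian is the reduced Lagrangian of the right-trivialized velocity. -/
lemma RightInvariant.eq_reducedLagrangian {L : TangentBundle I K → ℝ} (hL : RightInvariant I L)
    (x : K) (w : TangentSpace I x) :
    L ⟨x, w⟩ = reducedLagrangian I L (rightTranslate I x⁻¹ x w) := by
  -- `x * x⁻¹` equals the identity only propositionally; the equality is eliminated at a free point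
  -- `y`, all fibres having underlying type `F`.
  have key : ∀ (y : K) (_ : y = 1) (v : F), L ⟨y, v⟩ = L ⟨1, v⟩ := by
    rintro y rfl v; rfl
  rw [← hL x⁻¹ x w]
  exact key _ (mul_inv_cancel x) _

variable (K) in
/-- The coordinates of the identity in the preferred chart at the identity. -/
def idCoord : F := extChartAt I (1 : K) 1

lemma extChartAt_one_symm_idCoord : (extChartAt I (1 : K)).symm (idCoord I K) = 1 :=
  extChartAt_to_inv 1

lemma eventually_extChartAt_one_symm :
    ∀ᶠ y in 𝓝 (1 : K), (extChartAt I (1 : K)).symm (extChartAt I (1 : K) y) = y := by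
  filter_upwards [extChartAt_source_mem_nhds (I := I) (1 : K)] with y hy
  exact (extChartAt I (1 : K)).left_inv hy

lemma eventually_extChartAt_one [I.Boundaryless] :
    ∀ᶠ x in 𝓝 (idCoord I K), extChartAt I (1 : K) ((extChartAt I (1 : K)).symm x) = x := by
  filter_upwards [extChartAt_target_mem_nhds (I := I) (1 : K)] with x hx
  exact (extChartAt I (1 : K)).right_inv hx

lemma contMDiffAt_extChartAt_one {y : K} (hy : y = 1) :
    ContMDiffAt I 𝓘(ℝ, F) ∞ (extChartAt I (1 : K)) y := by
  subst hy; exact contMDiffAt_extChartAt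

variable (K) in
/-- The multiplication in the preferred chart at the identity. -/
def chartMul (p : F × F) : F :=
  extChartAt I (1 : K) ((extChartAt I (1 : K)).symm p.1 * (extChartAt I (1 : K)).symm p.2)

/-- The right quotient `x y⁻¹`, with arguments read in a chart `e` and values in the preferred
chart at the identity. -/
def chartDiv (e : OpenPartialHomeomorph K H) (p : F × F) : F :=
  extChartAt I (1 : K) ((e.extend I).symm p.1 * ((e.extend I).symm p.2)⁻¹)

/-- The right trivialization of the tangent bundle in a chart. -/
def chartTriv (e : OpenPartialHomeomorph K H) (q : F) : F →L[ℝ] F :=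
  (fderiv ℝ (chartDiv I e) (q, q)).comp (ContinuousLinearMap.inl ℝ F F)

variable (K) in
/-- The mixed second derivative of the multiplication at the identity. -/
def mulHessian (u w : F) : F :=
  fderiv ℝ (fderiv ℝ (chartMul I K)) (idCoord I K, idCoord I K) (u, 0) (0, w)

variable [LieGroup I ∞ K]

/-- The preferred chart has identity derivative at its centre, so it may be inserted in front of a
map without changing a tangent vector there. A free `y` equal to `1` covers points of the form `x *
x⁻¹`. -/
lemma mfderiv_extChartAt_one {y : K} (hy : y = 1) (w : TangentSpace I y) :
    mfderiv I 𝓘(ℝ, F) (extChartAt I (1 : K)) y w = (show F from w) := by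
  have : IsManifold I 1 K := IsManifold.of_le (n := ∞) (by norm_cast)
  subst hy
  rw [mfderiv_extChartAt_self]
  rfl

/-- Right trivialization of the derivative of a map into a Lie group, computed in the preferred
chart at the identity. -/
lemma rightTranslate_mfderiv {f : X → K} {x : X} (hf : MDifferentiableAt 𝓘(ℝ, X) I f x) (w : X) :
    (rightTranslate I (f x)⁻¹ (f x) (mfderiv 𝓘(ℝ, X) I f x w) : F) =
      fderiv ℝ (fun y => extChartAt I (1 : K) (f y * (f x)⁻¹)) x w := by
  have h1 : MDifferentiableAt I I (fun y => y * (f x)⁻¹) (f x) :=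
    (contMDiff_mul_right (I := I) (n := ∞)).mdifferentiableAt (by simp)
  have h2 : f x * (f x)⁻¹ = 1 := mul_inv_cancel _
  have h3 : MDifferentiableAt I 𝓘(ℝ, F) (extChartAt I (1 : K)) (f x * (f x)⁻¹) :=
    (contMDiffAt_extChartAt_one I h2).mdifferentiableAt (by simp)
  rw [← mfderiv_eq_fderiv]
  have h4 := mfderiv_comp x h3 (h1.comp x hf)
  have h5 := mfderiv_comp x h1 hf
  have h6 : (fun y => extChartAt I (1 : K) (f y * (f x)⁻¹)) =
    extChartAt I (1 : K) ∘ ((fun y => y * (f x)⁻¹) ∘ f) := rfl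
  rw [h6, h4, h5]
  exact (mfderiv_extChartAt_one I h2 _).symm

/-- The right-trivialized velocity in the preferred chart at the identity. -/
lemma rightTrivializedVelocity_eq_deriv {c : ℝ → K} {t : ℝ}
    (hc : MDifferentiableAt 𝓘(ℝ, ℝ) I c t) :
    rightTrivializedVelocity I c t = deriv (fun s => extChartAt I (1 : K) (c s * (c t)⁻¹)) t := by
  rw [← fderiv_apply_one_eq_deriv]
  exact rightTranslate_mfderiv I hc 1

/-- The logarithmic difference of two maps into the group with the same value is smooth. -/
lemma contDiffAt_extChartAt_mul_inv {f g : X → K} {x : X} (hf : ContMDiffAt 𝓘(ℝ, X) I ∞ f x)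
    (hg : ContMDiffAt 𝓘(ℝ, X) I ∞ g x) (h : f x = g x) :
    ContDiffAt ℝ ∞ (fun y => extChartAt I (1 : K) (f y * (g y)⁻¹)) x := by
  rw [← contMDiffAt_iff_contDiffAt]
  exact (contMDiffAt_extChartAt_one I (by simp [h])).comp x (hf.mul hg.inv)

variable [I.Boundaryless]

lemma contMDiffAt_extChartAt_one_symm :
    ContMDiffAt 𝓘(ℝ, F) I ∞ (extChartAt I (1 : K)).symm (idCoord I K) :=
  contMDiffAt_extend_symm I (IsManifold.chart_mem_maximalAtlas (1 : K))
    (mem_extChartAt_target (I := I) (1 : K))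

lemma contDiffAt_chartMul : ContDiffAt ℝ ∞ (chartMul I K) (idCoord I K, idCoord I K) := by
  rw [← contMDiffAt_iff_contDiffAt]
  have h1 : ContMDiffAt 𝓘(ℝ, F × F) I ∞ (fun p : F × F => (extChartAt I (1 : K)).symm p.1)
      (idCoord I K, idCoord I K) :=
    (contMDiffAt_extChartAt_one_symm I).comp (f := Prod.fst) (idCoord I K, idCoord I K)
      contDiff_fst.contMDiff.contMDiffAt
  have h2 : ContMDiffAt 𝓘(ℝ, F × F) I ∞ (fun p : F × F => (extChartAt I (1 : K)).symm p.2)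
      (idCoord I K, idCoord I K) :=
    (contMDiffAt_extChartAt_one_symm I).comp (f := Prod.snd) (idCoord I K, idCoord I K)
      contDiff_snd.contMDiff.contMDiffAt
  refine (contMDiffAt_extChartAt_one I ?_).comp (idCoord I K, idCoord I K) (h1.mul h2)
  simp only [extChartAt_one_symm_idCoord, mul_one]

variable {e : OpenPartialHomeomorph K H}

lemma contDiffAt_chartDiv (he : e ∈ IsManifold.maximalAtlas I ∞ K)
    {q : F} (hq : q ∈ (e.extend I).target) :
    ContDiffAt ℝ ∞ (chartDiv I e) (q, q) :=
  contDiffAt_extChartAt_mul_inv I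
    ((contMDiffAt_extend_symm I he hq).comp (f := Prod.fst) (q, q)
      contDiff_fst.contMDiff.contMDiffAt)
    ((contMDiffAt_extend_symm I he hq).comp (f := Prod.snd) (q, q)
      contDiff_snd.contMDiff.contMDiffAt) rfl

lemma contDiffAt_chartTriv (he : e ∈ IsManifold.maximalAtlas I ∞ K)
    {q : F} (hq : q ∈ (e.extend I).target) :
    ContDiffAt ℝ ∞ (chartTriv I e) q := by
  have h : ContDiffAt ℝ ∞ (fderiv ℝ (chartDiv I e)) (q, q) :=
    (contDiffAt_chartDiv I he hq).fderiv_right (by simp)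
  have h2 : ContDiffAt ℝ ∞ (fun q : F => (q, q)) q := contDiffAt_id.prodMk contDiffAt_id
  exact (ContDiffAt.comp (f := fun q : F => (q, q)) q h h2).clm_comp contDiffAt_const

/-- The right-trivialized velocity of a map, expressed in a chart. -/
lemma fderiv_extChartAt_mul_inv (he : e ∈ IsManifold.maximalAtlas I ∞ K)
    {f : X → K} {x : X} (hf : MDifferentiableAt 𝓘(ℝ, X) I f x)
    (hx : f x ∈ e.source) (w : X) :
    fderiv ℝ (fun y => extChartAt I (1 : K) (f y * (f x)⁻¹)) x w =
      chartTriv I e (e.extend I (f x)) (fderiv ℝ (fun y => e.extend I (f y)) x w) := by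
  have hq : e.extend I (f x) ∈ (e.extend I).target :=
    (e.extend I).map_source (by rwa [e.extend_source])
  have h1 : (fun y => extChartAt I (1 : K) (f y * (f x)⁻¹)) =ᶠ[𝓝 x]
      fun y => chartDiv I e (e.extend I (f y), e.extend I (f x)) := by
    filter_upwards [hf.continuousAt.eventually (e.open_source.mem_nhds hx)] with y hy
    simp only [chartDiv]
    rw [e.extend_left_inv hy, e.extend_left_inv hx]
  have h2 : DifferentiableAt ℝ (fun y => e.extend I (f y)) x := by
    rw [← mdifferentiableAt_iff_differentiableAt]
    exact ((e.contMDiffAt_extend he hx).mdifferentiableAt (by simp)).comp x hf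
  have h3 := ((contDiffAt_chartDiv I he hq).differentiableAt (by simp)).hasFDerivAt.comp x
    (f := fun y => (e.extend I (f y), e.extend I (f x)))
    (h2.hasFDerivAt.prodMk (hasFDerivAt_const _ x))
  rw [h1.fderiv_eq]
  erw [h3.fderiv]
  simp [chartTriv]

/-- The right-trivialized velocity of a curve, expressed in a chart. -/
lemma rightTrivializedVelocity_eq_chartTriv (he : e ∈ IsManifold.maximalAtlas I ∞ K)
    {c : ℝ → K} {t : ℝ}
    (hc : MDifferentiableAt 𝓘(ℝ, ℝ) I c t) (ht : c t ∈ e.source) :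
    rightTrivializedVelocity I c t =
      chartTriv I e (e.extend I (c t)) (deriv (fun s => e.extend I (c s)) t) := by
  rw [rightTrivializedVelocity_eq_deriv I hc, ← fderiv_apply_one_eq_deriv,
    ← fderiv_apply_one_eq_deriv]
  exact fderiv_extChartAt_mul_inv I he hc ht 1

/-- A right-invariant Lagrangian in a chart. -/
lemma localLagrangian_eq (he : e ∈ IsManifold.maximalAtlas I ∞ K)
    {L : TangentBundle I K → ℝ} (hL : RightInvariant I L) {q : F}
    (hq : q ∈ (e.extend I).target) (w : F) :
    localLagrangian I L e q w = reducedLagrangian I L (chartTriv I e q w) := by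
  have h1 : MDifferentiableAt 𝓘(ℝ, F) I (e.extend I).symm q :=
    (contMDiffAt_extend_symm I he hq).mdifferentiableAt (by simp)
  have h2 : (e.extend I).symm q ∈ e.source := by
    rw [← e.extend_source (I := I)]; exact (e.extend I).map_target hq
  -- The inverse chart has the identity as its own coordinate expression, so its right-trivialized
  -- derivative is `chartTriv` itself.
  have h3 : (fun y => e.extend I ((e.extend I).symm y)) =ᶠ[𝓝 q] id := by
    filter_upwards [e.isOpen_extend_target.mem_nhds hq] with y hy using (e.extend I).right_inv hy
  unfold localLagrangian
  rw [hL.eq_reducedLagrangian I, rightTranslate_mfderiv I h1,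
    fderiv_extChartAt_mul_inv I he h1 h2, h3.fderiv_eq, (e.extend I).right_inv hq]
  simp

end RightTrivialization

/-! ### The Maurer–Cartan equation in charts -/

section MaurerCartan

variable {F : Type*} [NormedAddCommGroup F] [NormedSpace ℝ F]
  {H : Type*} [TopologicalSpace H] (I : ModelWithCorners ℝ F H)
  {K : Type*} [TopologicalSpace K] [ChartedSpace H K] [Group K]

variable (K) in
/-- The antisymmetrized second derivative of the multiplication at the identity. -/
def mulBracket (u w : F) : F := mulHessian I K u w - mulHessian I K w u

lemma chartMul_right_idCoord [I.Boundaryless] :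
    (fun x => chartMul I K (x, idCoord I K)) =ᶠ[𝓝 (idCoord I K)] id := by
  filter_upwards [eventually_extChartAt_one (K := K) I] with x hx
  simp only [chartMul, extChartAt_one_symm_idCoord, mul_one, hx, id]

lemma chartDiv_self (e : OpenPartialHomeomorph K H) (q : F) : chartDiv I e (q, q) = idCoord I K := by
  simp only [chartDiv, mul_inv_cancel, idCoord]

variable [LieGroup I ∞ K] [I.Boundaryless]

lemma fderiv_chartMul_inl (x : F) :
    fderiv ℝ (chartMul I K) (idCoord I K, idCoord I K) (x, 0) = x := by
  have h := ((contDiffAt_chartMul (K := K) I).differentiableAt (by simp)).hasFDerivAt.comp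
    (idCoord I K) (f := fun x => (x, idCoord I K))
    ((hasFDerivAt_id _).prodMk (hasFDerivAt_const _ _))
  have h2 := h.fderiv
  erw [(chartMul_right_idCoord (K := K) I).fderiv_eq] at h2
  simpa using (congrArg (fun l => l x) h2).symm

/-- With the second factor at the unit, multiplication is the identity map near the unit, hence has
no pure second derivative: only mixed terms of the Hessian will survive. -/
lemma fderiv_fderiv_chartMul_inl (x y : F) :
    fderiv ℝ (fderiv ℝ (chartMul I K)) (idCoord I K, idCoord I K) (x, 0) (y, 0) = 0 := by
  have hf : ∀ z : F, HasFDerivAt (fun x : F => (x, idCoord I K))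
      (ContinuousLinearMap.inl ℝ F F) z := fun z => (hasFDerivAt_id _).prodMk (hasFDerivAt_const _ _)
  have hf' : fderiv ℝ (fun x : F => (x, idCoord I K)) = fun _ => ContinuousLinearMap.inl ℝ F F :=
    funext fun z => (hf z).fderiv
  have h := fderiv_fderiv_comp (f := fun x : F => (x, idCoord I K)) (x := idCoord I K)
    ((contDiffAt_chartMul (K := K) I).of_le (by norm_cast))
    (contDiffAt_id.prodMk contDiffAt_const) x y
  rw [hf', (chartMul_right_idCoord (K := K) I).fderiv.fderiv_eq] at h
  have hid : fderiv ℝ (id : F → F) = fun _ => ContinuousLinearMap.id ℝ F :=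
    funext fun z => fderiv_id
  rw [hid] at h
  simpa using h.symm

variable {e : OpenPartialHomeomorph K H}

/-- The cancellation `(x y⁻¹)(y z⁻¹) = x z⁻¹` with `z` fixed at `q`. It is local because both
quotients must stay in the chart at the identity. The right side is free of `y`, which is what makes
it useful. -/
lemma chartMul_chartDiv (he : e ∈ IsManifold.maximalAtlas I ∞ K) {q : F}
    (hq : q ∈ (e.extend I).target) :
    (fun p : F × F => chartMul I K (chartDiv I e p, chartDiv I e (p.2, q))) =ᶠ[𝓝 (q, q)]
      fun p => chartDiv I e (p.1, q) := by
  have hs : ContinuousAt (e.extend I).symm q := (contMDiffAt_extend_symm I he hq).continuousAt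
  have : IsTopologicalGroup K := topologicalGroup_of_lieGroup I ∞
  have h1 : ContinuousAt (fun p : F × F => (e.extend I).symm p.1) (q, q) :=
    ContinuousAt.comp (f := Prod.fst) hs continuousAt_fst
  have h2 : ContinuousAt (fun p : F × F => (e.extend I).symm p.2) (q, q) :=
    ContinuousAt.comp (f := Prod.snd) hs continuousAt_snd
  have h3 : Filter.Tendsto (fun p : F × F => (e.extend I).symm p.1 * ((e.extend I).symm p.2)⁻¹)
      (𝓝 (q, q)) (𝓝 1) := by
    simpa only [mul_inv_cancel] using h1.tendsto.mul h2.tendsto.inv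
  have h4 : Filter.Tendsto (fun p : F × F => (e.extend I).symm p.2 * ((e.extend I).symm q)⁻¹)
      (𝓝 (q, q)) (𝓝 1) := by
    simpa only [mul_inv_cancel] using h2.tendsto.mul_const ((e.extend I).symm q)⁻¹
  filter_upwards [h3.eventually (eventually_extChartAt_one_symm (K := K) I),
    h4.eventually (eventually_extChartAt_one_symm (K := K) I)] with p hp1 hp2
  simp only [chartMul, chartDiv]
  rw [hp1, hp2]
  simp [mul_assoc]

/-- The mixed second derivative of the right quotient. -/
lemma fderiv_fderiv_chartDiv (he : e ∈ IsManifold.maximalAtlas I ∞ K) {q : F}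
    (hq : q ∈ (e.extend I).target) (u w : F) :
    fderiv ℝ (fderiv ℝ (chartDiv I e)) (q, q) (w, 0) (0, u) =
      -mulHessian I K (chartTriv I e q w) (chartTriv I e q u) := by
  have hD : ContDiffAt ℝ 2 (chartDiv I e) (q, q) :=
    (contDiffAt_chartDiv I he hq).of_le (by norm_cast)
  have hP : ContDiffAt ℝ 2 (fun y => chartDiv I e (y, q)) q :=
    ContDiffAt.comp (f := fun y : F => (y, q)) q hD (contDiffAt_id.prodMk contDiffAt_const)
  have hP1 : ContDiffAt ℝ 2 (fun p : F × F => chartDiv I e (p.2, q)) (q, q) :=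
    ContDiffAt.comp (f := Prod.snd) (q, q) hP contDiffAt_snd
  have hdP : HasFDerivAt (fun y => chartDiv I e (y, q)) (chartTriv I e q) q :=
    (hD.differentiableAt (by simp)).hasFDerivAt.comp q (f := fun y : F => (y, q))
      ((hasFDerivAt_id _).prodMk (hasFDerivAt_const _ _))
  have hdP1 : HasFDerivAt (fun p : F × F => chartDiv I e (p.2, q))
      ((chartTriv I e q).comp (ContinuousLinearMap.snd ℝ F F)) (q, q) :=
    HasFDerivAt.comp (f := Prod.snd) (q, q) hdP hasFDerivAt_snd
  have hh : ContDiffAt ℝ 2 (fun p : F × F => (chartDiv I e p, chartDiv I e (p.2, q))) (q, q) :=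
    hD.prodMk hP1
  have hdh := (hD.differentiableAt (by simp)).hasFDerivAt.prodMk hdP1
  have hm : ContDiffAt ℝ 2 (chartMul I K) (chartDiv I e (q, q), chartDiv I e (q, q)) := by
    rw [chartDiv_self]; exact (contDiffAt_chartMul (K := K) I).of_le (by norm_cast)
  -- The cancellation identity is differentiated twice, in direction `w` for `x` and `u` for `y`.
  have key := fderiv_fderiv_comp (f := fun p : F × F => (chartDiv I e p, chartDiv I e (p.2, q)))
    (x := (q, q)) hm hh (w, 0) (0, u)
  rw [(chartMul_chartDiv I he hq).fderiv.fderiv_eq] at key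
  have e1 := fderiv_fderiv_comp_clm (ContinuousLinearMap.fst ℝ F F) (x := (q, q)) hP (w, 0) (0, u)
  have e2 := fderiv_fderiv_comp_clm (ContinuousLinearMap.snd ℝ F F) (x := (q, q)) hP (w, 0) (0, u)
  have e3 := fderiv_fderiv_clm_comp (ContinuousLinearMap.fst ℝ F F) hh (w, 0) (0, u)
  have e4 := fderiv_fderiv_clm_comp (ContinuousLinearMap.snd ℝ F F) hh (w, 0) (0, u)
  simp only [ContinuousLinearMap.coe_fst', ContinuousLinearMap.coe_snd', map_zero,
    zero_apply] at e1 e2 e3 e4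
  rw [e2] at e4
  -- The factor `y z⁻¹` does not involve `x`, so its mixed derivative vanishes.
  have e5 : fderiv ℝ (fderiv ℝ fun p : F × F => (chartDiv I e p, chartDiv I e (p.2, q))) (q, q)
      (w, 0) (0, u) = (fderiv ℝ (fderiv ℝ (chartDiv I e)) (q, q) (w, 0) (0, u), 0) :=
    Prod.ext e3.symm e4.symm
  rw [e1, e5, hdh.fderiv] at key
  simp only [chartDiv_self, fderiv_chartMul_inl] at key
  have e6 : (fderiv ℝ (chartDiv I e) (q, q)) (w, 0) = chartTriv I e q w := rfl
  simp only [ContinuousLinearMap.prod_apply, ContinuousLinearMap.comp_apply,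
    ContinuousLinearMap.coe_snd', map_zero, e6] at key
  -- Varying `y` moves both factors. The part in the first factor meets a pure second derivative of
  -- the multiplication, which is zero; the rest is the mixed Hessian.
  have e7 : ((fderiv ℝ (chartDiv I e) (q, q)) (0, u), chartTriv I e q u) =
      ((fderiv ℝ (chartDiv I e) (q, q)) (0, u), 0) + (0, chartTriv I e q u) := by simp
  rw [e7, map_add, fderiv_fderiv_chartMul_inl, zero_add] at key
  exact (neg_eq_of_add_eq_zero_right key.symm).symm

/-- The Maurer–Cartan equation of the right trivialization. -/
lemma fderiv_chartTriv_sub (he : e ∈ IsManifold.maximalAtlas I ∞ K) {q : F}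
    (hq : q ∈ (e.extend I).target) (u w : F) :
    fderiv ℝ (chartTriv I e) q u w - fderiv ℝ (chartTriv I e) q w u =
      mulBracket I K (chartTriv I e q u) (chartTriv I e q w) := by
  have hD : ContDiffAt ℝ 2 (chartDiv I e) (q, q) :=
    (contDiffAt_chartDiv I he hq).of_le (by norm_cast)
  -- `chartTriv` is a partial derivative taken along the diagonal, so moving `q` moves both slots:
  -- one pure and one mixed second derivative.
  have hT : ∀ u w : F, fderiv ℝ (chartTriv I e) q u w =
      fderiv ℝ (fderiv ℝ (chartDiv I e)) (q, q) (u, 0) (w, 0) +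
      fderiv ℝ (fderiv ℝ (chartDiv I e)) (q, q) (w, 0) (0, u) := fun u w => by
    have h := (hD.differentiableAt_fderiv.hasFDerivAt.comp q (f := fun y : F => (y, y))
      ((hasFDerivAt_id q).prodMk (hasFDerivAt_id q))).clm_comp
      (hasFDerivAt_const (ContinuousLinearMap.inl ℝ F F) q)
    erw [h.fderiv]
    have : ((u, u) : F × F) = (u, 0) + (0, u) := by simp
    simp only [ContinuousLinearMap.comp_zero, zero_add, ContinuousLinearMap.comp_apply,
      ContinuousLinearMap.flip_apply, ContinuousLinearMap.compL_apply,
      ContinuousLinearMap.prod_apply, ContinuousLinearMap.id_apply,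
      ContinuousLinearMap.inl_apply]
    rw [hD.fderiv_fderiv_symm (w, 0) (0, u), this, map_add]
    simp
  -- The pure terms are symmetric in `u` and `w` and cancel.
  rw [hT, hT, fderiv_fderiv_chartDiv I he hq, fderiv_fderiv_chartDiv I he hq,
    hD.fderiv_fderiv_symm (w, 0) (u, 0), mulBracket]
  abel

/-- The map `z ↦ z g`, with `z` in the chart at the identity, has right quotient `z` by `g`, so its
right-trivialized derivative is the identity. Any `w` is therefore hit by the coordinate derivative
of this map in direction `w`. -/
lemma chartTriv_surjective (he : e ∈ IsManifold.maximalAtlas I ∞ K) {q : F}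
    (hq : q ∈ (e.extend I).target) : Function.Surjective (chartTriv I e q) := by
  intro w
  set f : F → K := fun z => (extChartAt I (1 : K)).symm z * (e.extend I).symm q with hf
  have hf0 : f (idCoord I K) = (e.extend I).symm q := by
    simp only [hf, extChartAt_one_symm_idCoord, one_mul]
  have h1 : MDifferentiableAt 𝓘(ℝ, F) I f (idCoord I K) :=
    ((contMDiffAt_extChartAt_one_symm I).mul contMDiffAt_const).mdifferentiableAt (by simp)
  have h2 : f (idCoord I K) ∈ e.source := by
    rw [hf0, ← e.extend_source (I := I)]; exact (e.extend I).map_target hq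
  have h3 : (fun y => extChartAt I (1 : K) (f y * (f (idCoord I K))⁻¹)) =ᶠ[𝓝 (idCoord I K)] id := by
    filter_upwards [eventually_extChartAt_one (K := K) I] with x hx
    rw [hf0]
    simp only [hf, mul_inv_cancel_right, hx, id]
  have h4 := fderiv_extChartAt_mul_inv I he h1 h2 w
  rw [h3.fderiv_eq, hf0, (e.extend I).right_inv hq, fderiv_id] at h4
  exact ⟨_, h4.symm⟩

end MaurerCartan

/-! ### Two-parameter families and their right-trivialized velocities -/

section Variations

variable {F : Type*} [NormedAddCommGroup F] [NormedSpace ℝ F]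
  {H : Type*} [TopologicalSpace H] (I : ModelWithCorners ℝ F H)
  {K : Type*} [TopologicalSpace K] [ChartedSpace H K] [Group K]
  [LieGroup I ∞ K] [I.Boundaryless]

/-- The right-trivialized velocities of the two families of coordinate curves of a surface `γ` are
smooth, and satisfy the Maurer–Cartan relation. -/
lemma rightTrivializedVelocity_variation {γ : ℝ → ℝ → K} {t : ℝ}
    (hγ : ContMDiffAt 𝓘(ℝ, ℝ × ℝ) I ∞ (fun p : ℝ × ℝ => γ p.1 p.2) (0, t)) :
    ContDiffAt ℝ ∞ (fun p : ℝ × ℝ => rightTrivializedVelocity I (γ p.1) p.2) (0, t) ∧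
    ContDiffAt ℝ ∞ (fun s => rightTrivializedVelocity I (fun ε => γ ε s) 0) t ∧
    HasDerivAt (fun ε => rightTrivializedVelocity I (γ ε) t)
      (deriv (fun s => rightTrivializedVelocity I (fun ε => γ ε s) 0) t -
        mulBracket I K (rightTrivializedVelocity I (γ 0) t)
          (rightTrivializedVelocity I (fun ε => γ ε t) 0)) 0 := by
  set e := chartAt H (γ 0 t) with he_def
  have he : e ∈ IsManifold.maximalAtlas I ∞ K := IsManifold.chart_mem_maximalAtlas _
  have hs : γ 0 t ∈ e.source := mem_chart_source H _
  set q : ℝ × ℝ → F := fun p => e.extend I (γ p.1 p.2) with hq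
  have hqt : q (0, t) ∈ (e.extend I).target :=
    (e.extend I).map_source (by rwa [e.extend_source])
  have hqs : ContDiffAt ℝ ∞ q (0, t) := by
    rw [← contMDiffAt_iff_contDiffAt]
    exact (e.contMDiffAt_extend he hs).comp (0, t) hγ
  have hq2 : ContDiffAt ℝ 2 q (0, t) := hqs.of_le (by norm_cast)
  -- The right-trivialized derivative of the surface in direction `v`, in coordinates; `(0, 1)` is
  -- time and `(1, 0)` the variation parameter.
  set W : ℝ × ℝ → ℝ × ℝ → F := fun v p => chartTriv I e (q p) (fderiv ℝ q p v) with hW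
  have hWs : ∀ v, ContDiffAt ℝ ∞ (W v) (0, t) := fun v =>
    ((contDiffAt_chartTriv I he hqt).comp (0, t) hqs).clm_apply
      ((hqs.fderiv_right (m := ∞) (by simp)).clm_apply contDiffAt_const)
  have hWd : ∀ v u, fderiv ℝ (W v) (0, t) u =
      fderiv ℝ (chartTriv I e) (q (0, t)) (fderiv ℝ q (0, t) u) (fderiv ℝ q (0, t) v) +
      chartTriv I e (q (0, t)) (fderiv ℝ (fderiv ℝ q) (0, t) u v) := fun v u => by
    have h1 := (((contDiffAt_chartTriv I he hqt).differentiableAt (by simp)).hasFDerivAt.comp (0, t)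
      (hqs.differentiableAt (by simp)).hasFDerivAt)
    have h2 := hq2.differentiableAt_fderiv.hasFDerivAt.clm_apply (hasFDerivAt_const v ((0, t) : ℝ × ℝ))
    have h3 := (h1.clm_apply h2).fderiv
    erw [h3]
    simp [add_comm]
  have hev : ∀ᶠ p in 𝓝 ((0, t) : ℝ × ℝ), γ p.1 p.2 ∈ e.source ∧
      MDifferentiableAt 𝓘(ℝ, ℝ × ℝ) I (fun p : ℝ × ℝ => γ p.1 p.2) p := by
    refine (hγ.continuousAt.eventually (e.open_source.mem_nhds hs)).and ?_
    have : IsManifold I 1 K := IsManifold.of_le (n := ∞) (by norm_cast)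
    exact ((contMDiffAt_iff_contMDiffAt_nhds (n := 1) (by simp)).1
      (hγ.of_le (by norm_cast))).mono fun p hp => hp.mdifferentiableAt (by simp)
  have hvert : ∀ᶠ p in 𝓝 ((0, t) : ℝ × ℝ),
      rightTrivializedVelocity I (γ p.1) p.2 = W (0, 1) p := by
    filter_upwards [hev, hq2.eventually_differentiableAt] with p hp hqp
    have hl : HasDerivAt (fun s : ℝ => (p.1, s)) (0, 1) p.2 :=
      (hasDerivAt_const _ _).prodMk (hasDerivAt_id _)
    have hc : MDifferentiableAt 𝓘(ℝ, ℝ) I (γ p.1) p.2 :=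
      hp.2.comp (f := fun s : ℝ => (p.1, s)) p.2 hl.differentiableAt.mdifferentiableAt
    rw [rightTrivializedVelocity_eq_chartTriv I he hc hp.1]
    exact congrArg _ (hqp.hasFDerivAt.comp_hasDerivAt p.2 (f := fun s : ℝ => (p.1, s)) hl).deriv
  have hhor : ∀ᶠ p in 𝓝 ((0, t) : ℝ × ℝ),
      rightTrivializedVelocity I (fun ε => γ ε p.2) p.1 = W (1, 0) p := by
    filter_upwards [hev, hq2.eventually_differentiableAt] with p hp hqp
    have hl : HasDerivAt (fun s : ℝ => (s, p.2)) (1, 0) p.1 :=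
      (hasDerivAt_id _).prodMk (hasDerivAt_const _ _)
    have hc : MDifferentiableAt 𝓘(ℝ, ℝ) I (fun ε => γ ε p.2) p.1 :=
      hp.2.comp (f := fun s : ℝ => (s, p.2)) p.1 hl.differentiableAt.mdifferentiableAt
    rw [rightTrivializedVelocity_eq_chartTriv I he hc hp.1]
    exact congrArg _ (hqp.hasFDerivAt.comp_hasDerivAt p.1 (f := fun s : ℝ => (s, p.2)) hl).deriv
  have hl1 : HasDerivAt (fun s : ℝ => ((0 : ℝ), s)) (0, 1) t :=
    (hasDerivAt_const _ _).prodMk (hasDerivAt_id _)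
  have hl2 : HasDerivAt (fun ε : ℝ => (ε, t)) (1, 0) 0 :=
    (hasDerivAt_id _).prodMk (hasDerivAt_const _ _)
  have hη : (fun s => rightTrivializedVelocity I (fun ε => γ ε s) 0) =ᶠ[𝓝 t]
      fun s => W (1, 0) (0, s) := hl1.continuousAt.eventually hhor
  have hΞ : (fun ε => rightTrivializedVelocity I (γ ε) t) =ᶠ[𝓝 0]
      fun ε => W (0, 1) (ε, t) := hl2.continuousAt.eventually hvert
  refine ⟨(hWs (0, 1)).congr_of_eventuallyEq hvert, ?_, ?_⟩
  · refine ContDiffAt.congr_of_eventuallyEq ?_ hη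
    exact ContDiffAt.comp (f := fun s : ℝ => ((0 : ℝ), s)) t (hWs (1, 0))
      (contDiffAt_const.prodMk contDiffAt_id)
  · have h1 := ((hWs (1, 0)).differentiableAt (by simp)).hasFDerivAt.comp_hasDerivAt t
      (f := fun s : ℝ => ((0 : ℝ), s)) hl1
    have h2 := ((hWs (0, 1)).differentiableAt (by simp)).hasFDerivAt.comp_hasDerivAt 0
      (f := fun ε : ℝ => (ε, t)) hl2
    refine HasDerivAt.congr_of_eventuallyEq ?_ hΞ
    refine h2.congr_deriv ?_
    rw [hη.deriv_eq, hvert.self_of_nhds, hhor.self_of_nhds]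
    erw [h1.deriv]
    -- The second derivatives of `q` agree by symmetry; what remains is the antisymmetrized
    -- derivative of `chartTriv`.
    rw [hWd, hWd, hq2.fderiv_fderiv_symm (1, 0) (0, 1)]
    rw [hW, ← fderiv_chartTriv_sub I he hqt]
    abel

end Variations

/-! ### The Lie bracket as the antisymmetrized Hessian of the multiplication -/

section Bracket

variable {F : Type*} [NormedAddCommGroup F] [NormedSpace ℝ F]
  {H : Type*} [TopologicalSpace H] (I : ModelWithCorners ℝ F H)
  {K : Type*} [TopologicalSpace K] [ChartedSpace H K] [Group K]
  [LieGroup I ∞ K] [I.Boundaryless]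

lemma eventually_chartMul_differentiableAt :
    ∀ᶠ x in 𝓝 (idCoord I K), DifferentiableAt ℝ (chartMul I K) (x, idCoord I K) := by
  have h : Filter.Tendsto (fun x : F => (x, idCoord I K)) (𝓝 (idCoord I K))
      (𝓝 (idCoord I K, idCoord I K)) := by
    have : ContinuousAt (fun x : F => (x, idCoord I K)) (idCoord I K) := by fun_prop
    exact this
  exact h.eventually
    ((contDiffAt_chartMul (K := K) I).of_le (by norm_cast)).eventually_differentiableAt

/-- Left-invariant vector fields in the preferred chart at the identity. -/
lemma mpullbackWithin_mulInvariantVectorField (v : F) {x : F}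
    (hx : x ∈ (extChartAt I (1 : K)).target)
    (hd : DifferentiableAt ℝ (chartMul I K) (x, idCoord I K)) :
    (VectorField.mpullbackWithin 𝓘(ℝ, F) I (extChartAt I (1 : K)).symm
      (mulInvariantVectorField (I := I) (G := K) v) (range I) x : F) =
      fderiv ℝ (chartMul I K) (x, idCoord I K) ((0 : F), v) := by
  have : IsManifold I 1 K := IsManifold.of_le (n := ∞) (by norm_cast)
  set g : K := (extChartAt I (1 : K)).symm x with hg
  -- The derivatives of the chart and of its inverse are mutually inverse, so pulling back along the
  -- inverse chart is applying the derivative of the chart.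
  have hinv := ContinuousLinearMap.inverse_eq
    (mfderivWithin_extChartAt_symm_comp_mfderiv_extChartAt (I := I) hx)
    (mfderiv_extChartAt_comp_mfderivWithin_extChartAt_symm (I := I) hx)
  rw [VectorField.mpullbackWithin_apply, hinv]
  have hgs : g ∈ (chartAt H (1 : K)).source := by
    rw [← extChartAt_source I]; exact (extChartAt I (1 : K)).map_target hx
  have h1 : MDifferentiableAt I 𝓘(ℝ, F) (extChartAt I (1 : K)) (g * 1) := by
    rw [mul_one]; exact mdifferentiableAt_extChartAt hgs
  have h2 : MDifferentiableAt I I (fun y => g * y) (1 : K) :=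
    (contMDiff_mul_left (I := I) (n := ∞)).mdifferentiableAt (by simp)
  have h3 := mfderiv_comp (1 : K) h1 h2
  have h4 : mfderiv I 𝓘(ℝ, F) (extChartAt I (1 : K) ∘ fun y => g * y) (1 : K) =
      fderiv ℝ (fun y => chartMul I K (x, y)) (idCoord I K) := by
    have h5 := (h1.comp (1 : K) h2).mfderiv
    rw [I.range_eq_univ, fderivWithin_univ] at h5
    exact h5
  have hd1 : HasFDerivAt (fun y : F => (x, y)) (ContinuousLinearMap.inr ℝ F F) (idCoord I K) :=
    (hasFDerivAt_const _ _).prodMk (hasFDerivAt_id _)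
  have h6 : fderiv ℝ (fun y => chartMul I K (x, y)) (idCoord I K) =
      (fderiv ℝ (chartMul I K) (x, idCoord I K)).comp (ContinuousLinearMap.inr ℝ F F) :=
    (hd.hasFDerivAt.comp (idCoord I K) hd1).fderiv
  -- The chain rule lands at `g * 1` while the field lives at `g`; this transports between the two
  -- fibres.
  have h7 : ∀ (k : K) (hk : k = g) (l : F →L[ℝ] F),
      (mfderiv I 𝓘(ℝ, F) (extChartAt I (1 : K)) g : F →L[ℝ] F).comp l =
      (mfderiv I 𝓘(ℝ, F) (extChartAt I (1 : K)) k : F →L[ℝ] F).comp l := by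
    rintro k rfl l; rfl
  have h8 := h7 (g * 1) (mul_one g) (mfderiv I I (fun y => g * y) (1 : K))
  have h9 := h8.trans (h3.symm.trans (h4.trans h6))
  exact congrArg (fun l : F →L[ℝ] F => l v) h9

lemma fderiv_chartMul_inr (y : F) :
    fderiv ℝ (chartMul I K) (idCoord I K, idCoord I K) (0, y) = y := by
  have h1 : (fun y => chartMul I K (idCoord I K, y)) =ᶠ[𝓝 (idCoord I K)] id := by
    filter_upwards [eventually_extChartAt_one (K := K) I] with x hx
    simp only [chartMul, extChartAt_one_symm_idCoord, one_mul, hx, id]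
  have h := ((contDiffAt_chartMul (K := K) I).differentiableAt (by simp)).hasFDerivAt.comp
    (idCoord I K) (f := fun x => (idCoord I K, x))
    ((hasFDerivAt_const _ _).prodMk (hasFDerivAt_id _))
  have h2 := h.fderiv
  erw [h1.fderiv_eq] at h2
  simpa using (congrArg (fun l => l y) h2).symm

/-- The Lie bracket of a Lie group is the antisymmetrized second derivative of the
multiplication. -/
lemma mlieBracket_mulInvariantVectorField (v w : F) :
    (VectorField.mlieBracket I (mulInvariantVectorField (I := I) (G := K) v)
      (mulInvariantVectorField (I := I) (G := K) w) (1 : K) : F) = mulBracket I K v w := by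
  have : IsManifold I 1 K := IsManifold.of_le (n := ∞) (by norm_cast)
  have hC : ContDiffAt ℝ 2 (chartMul I K) (idCoord I K, idCoord I K) :=
    (contDiffAt_chartMul (K := K) I).of_le (by norm_cast)
  have hev : ∀ v : F,
      (VectorField.mpullbackWithin 𝓘(ℝ, F) I (extChartAt I (1 : K)).symm
        (mulInvariantVectorField (I := I) (G := K) v) (range I) : F → F) =ᶠ[𝓝 (idCoord I K)]
      fun x => fderiv ℝ (chartMul I K) (x, idCoord I K) ((0 : F), v) := fun v => by
    filter_upwards [eventually_chartMul_differentiableAt (K := K) I,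
      extChartAt_target_mem_nhds (I := I) (1 : K)] with x hd hx
    exact mpullbackWithin_mulInvariantVectorField I v hx hd
  -- In coordinates the left-invariant field of `v` is the derivative of the product in its second
  -- slot; differentiating in the base point gives the mixed Hessian.
  have hD : ∀ v u : F, fderiv ℝ (fun x => fderiv ℝ (chartMul I K) (x, idCoord I K) ((0 : F), v))
      (idCoord I K) u = mulHessian I K u v := fun v u => by
    have h1 : HasFDerivAt (fun x : F => (x, idCoord I K)) (ContinuousLinearMap.inl ℝ F F)
      (idCoord I K) := (hasFDerivAt_id _).prodMk (hasFDerivAt_const _ _)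
    have h2 := (hC.differentiableAt_fderiv.hasFDerivAt.comp (idCoord I K)
      (f := fun x : F => (x, idCoord I K)) h1).clm_apply
      (hasFDerivAt_const ((0 : F), v) (idCoord I K))
    erw [h2.fderiv]
    simp [mulHessian]
  have hinv : ∀ (l : F →L[ℝ] F) (_ : l = ContinuousLinearMap.id ℝ F) (z : F), l.inverse z = z := by
    rintro l rfl z; rw [ContinuousLinearMap.inverse_id]; rfl
  rw [← VectorField.mlieBracketWithin_univ, VectorField.mlieBracketWithin_apply]
  refine (hinv _ (mfderiv_extChartAt_self (I := I) (x := (1 : K))) _).trans ?_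
  have hs : (extChartAt I (1 : K)).symm ⁻¹' univ ∩ range I = univ := by
    rw [I.range_eq_univ, preimage_univ, univ_inter]
  have hlie : ∀ (f g f' g' : F → F) (a : F), f =ᶠ[𝓝 a] f' → g =ᶠ[𝓝 a] g' →
      VectorField.lieBracketWithin ℝ f g univ a =
        fderiv ℝ g' a (f' a) - fderiv ℝ f' a (g' a) := fun f g f' g' a hf hg => by
    rw [VectorField.lieBracketWithin_univ, VectorField.lieBracket_eq]
    simp only [hf.fderiv_eq, hg.fderiv_eq, hf.self_of_nhds, hg.self_of_nhds]
  rw [hs]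
  refine (hlie _ _ _ _ _ (hev v) (hev w)).trans ?_
  simp only [fderiv_chartMul_inr, hD, mulBracket]

end Bracket

/-! ### The bracket of the centered semi-direct product -/

section BowtieBracket

variable {E G V : Type*} [NormedAddCommGroup E] [NormedSpace ℝ E]
  [TopologicalSpace G] [ChartedSpace E G] [Group G]
  [NormedAddCommGroup V] [NormedSpace ℝ V]

lemma lieBr_eq_mulBracket [LieGroup 𝓘(ℝ, E) ∞ G] (ξ η : E) :
    lieBr G ξ η = mulBracket 𝓘(ℝ, E) G ξ η :=
  mlieBracket_mulInvariantVectorField 𝓘(ℝ, E) ξ η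

variable (A : CommutingReps E G V)

lemma Bowtie.extChartAt_one :
    extChartAt (𝓘(ℝ, E).prod 𝓘(ℝ, V)) (1 : Bowtie A) =
      ((extChartAt 𝓘(ℝ, E) (1 : G)).prod (PartialEquiv.refl V) : PartialEquiv (G × V) (E × V)) := by
  have h := extChartAt_prod (I := 𝓘(ℝ, E)) (I' := 𝓘(ℝ, V)) (((1 : G), (0 : V)) : G × V)
  rw [extChartAt_model_space_eq_id] at h
  exact h

lemma Bowtie.chartMul_eq (p : (E × V) × (E × V)) :
    chartMul (𝓘(ℝ, E).prod 𝓘(ℝ, V)) (Bowtie A) p =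
      (chartMul 𝓘(ℝ, E) G (p.1.1, p.2.1),
        A.left ((extChartAt 𝓘(ℝ, E) (1 : G)).symm p.1.1) p.2.2 +
          A.right (.op ((extChartAt 𝓘(ℝ, E) (1 : G)).symm p.2.1)) p.1.2) := by
  unfold chartMul
  rw [Bowtie.extChartAt_one]
  rfl

lemma Bowtie.idCoord_eq : idCoord (𝓘(ℝ, E).prod 𝓘(ℝ, V)) (Bowtie A) =
    (idCoord 𝓘(ℝ, E) G, (0 : V)) := by
  unfold idCoord
  rw [Bowtie.extChartAt_one]
  rfl

/-- A manifold derivative at the identity is by definition the derivative in the preferred chart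
there, so infinitesimal actions can be computed along coordinate lines. -/
lemma hasDerivAt_comp_extChartAt_one_symm {f : G → V} {l : E →L[ℝ] V}
    (hf : MDifferentiableAt 𝓘(ℝ, E) 𝓘(ℝ, V) f 1)
    (hl : mfderiv 𝓘(ℝ, E) 𝓘(ℝ, V) f 1 = l) (ξ : E) :
    HasDerivAt (fun s : ℝ => f ((extChartAt 𝓘(ℝ, E) (1 : G)).symm (idCoord 𝓘(ℝ, E) G + s • ξ)))
      (l ξ) 0 := by
  have h : HasFDerivWithinAt (fun z => f ((extChartAt 𝓘(ℝ, E) (1 : G)).symm z)) l univ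
      (idCoord 𝓘(ℝ, E) G) := by
    have h := hf.hasMFDerivAt.2
    rw [ModelWithCorners.range_eq_univ, hl] at h
    exact h
  have h2 : HasDerivAt (fun s : ℝ => idCoord 𝓘(ℝ, E) G + s • ξ) ξ 0 := by
    simpa using ((hasDerivAt_id (0 : ℝ)).smul_const ξ).const_add (idCoord 𝓘(ℝ, E) G)
  exact HasFDerivAt.comp_hasDerivAt_of_eq (0 : ℝ) (hasFDerivWithinAt_univ.1 h) h2 (by simp)

/-- The `V`-part `g · w + v · h` of the product is linear in `w` and in `v`, which both vanish at
the identity. Its mixed derivative thus differentiates each action exactly once. -/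
lemma Bowtie.mulHessian_eq [LieGroup 𝓘(ℝ, E) ∞ G] (x y : E × V) :
    mulHessian (𝓘(ℝ, E).prod 𝓘(ℝ, V)) (Bowtie A) x y =
      (mulHessian 𝓘(ℝ, E) G x.1 y.1, A.infLeft y.2 x.1 + A.infRight x.2 y.1) := by
  have hK : ContDiffAt ℝ 2 (chartMul (𝓘(ℝ, E).prod 𝓘(ℝ, V)) (Bowtie A))
      (idCoord (𝓘(ℝ, E).prod 𝓘(ℝ, V)) (Bowtie A), idCoord (𝓘(ℝ, E).prod 𝓘(ℝ, V)) (Bowtie A)) :=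
    (contDiffAt_chartMul (K := Bowtie A) (𝓘(ℝ, E).prod 𝓘(ℝ, V))).of_le (by norm_cast)
  have hG : ContDiffAt ℝ 2 (chartMul 𝓘(ℝ, E) G) (idCoord 𝓘(ℝ, E) G, idCoord 𝓘(ℝ, E) G) :=
    (contDiffAt_chartMul (K := G) 𝓘(ℝ, E)).of_le (by norm_cast)
  have h1 := fderiv_fderiv_clm_comp (ContinuousLinearMap.fst ℝ E V) hK (x, 0) (0, y)
  have h2 := fderiv_fderiv_clm_comp (ContinuousLinearMap.snd ℝ E V) hK (x, 0) (0, y)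
  have hK2 : ContDiffAt ℝ 2 (fun p => (chartMul (𝓘(ℝ, E).prod 𝓘(ℝ, V)) (Bowtie A) p).2)
      (idCoord (𝓘(ℝ, E).prod 𝓘(ℝ, V)) (Bowtie A), idCoord (𝓘(ℝ, E).prod 𝓘(ℝ, V)) (Bowtie A)) :=
    ContDiffAt.comp _ contDiffAt_snd hK
  refine Prod.ext (Eq.trans h1.symm ?_) (Eq.trans h2.symm ?_)
  · let l : (E × V) × (E × V) →L[ℝ] E × E :=
      (ContinuousLinearMap.fst ℝ E V).prodMap (ContinuousLinearMap.fst ℝ E V)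
    have h3 : (fun p => ContinuousLinearMap.fst ℝ E V
        (chartMul (𝓘(ℝ, E).prod 𝓘(ℝ, V)) (Bowtie A) p)) = fun p => chartMul 𝓘(ℝ, E) G (l p) := by
      funext p; rw [Bowtie.chartMul_eq]; rfl
    rw [h3, Bowtie.idCoord_eq, fderiv_fderiv_comp_clm l hG]
    rfl
  · have h3 : (fun p => ContinuousLinearMap.snd ℝ E V
        (chartMul (𝓘(ℝ, E).prod 𝓘(ℝ, V)) (Bowtie A) p)) =
        fun p => (chartMul (𝓘(ℝ, E).prod 𝓘(ℝ, V)) (Bowtie A) p).2 := rfl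
    rw [h3, fderiv_fderiv_eq_deriv_deriv hK2, Bowtie.idCoord_eq]
    simp only [Bowtie.chartMul_eq, Prod.fst_add, Prod.snd_add, Prod.smul_fst, Prod.smul_snd,
      smul_zero, add_zero, zero_add, map_smul]
    have h4 : ∀ v : V, mfderiv 𝓘(ℝ, E) 𝓘(ℝ, V) (fun g : G => A.left g v) 1 = A.infLeft v :=
      fun _ => rfl
    have h5 : ∀ v : V, mfderiv 𝓘(ℝ, E) 𝓘(ℝ, V) (fun g : G => A.right (.op g) v) 1 = A.infRight v :=
      fun _ => rfl
    -- The left term is linear in `r`, so its `r`-derivative keeps the action of the point at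
    -- parameter `s`; the right term has its action differentiated. The outer derivative in `s` then
    -- exchanges these roles.
    have h6 : ∀ s : ℝ, deriv (fun r : ℝ =>
        r • A.left ((extChartAt 𝓘(ℝ, E) (1 : G)).symm (idCoord 𝓘(ℝ, E) G + s • x.1)) y.2 +
        s • A.right (.op ((extChartAt 𝓘(ℝ, E) (1 : G)).symm (idCoord 𝓘(ℝ, E) G + r • y.1))) x.2) 0 =
        A.left ((extChartAt 𝓘(ℝ, E) (1 : G)).symm (idCoord 𝓘(ℝ, E) G + s • x.1)) y.2 +
          s • A.infRight x.2 y.1 := fun s => by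
      have h7 := ((hasDerivAt_id (0 : ℝ)).smul_const
        (A.left ((extChartAt 𝓘(ℝ, E) (1 : G)).symm (idCoord 𝓘(ℝ, E) G + s • x.1)) y.2)).add
        ((hasDerivAt_comp_extChartAt_one_symm (A.mdifferentiableAt_right x.2) (h5 x.2)
          y.1).const_smul s)
      rw [one_smul] at h7
      exact h7.deriv
    simp only [h6]
    have h8 := (hasDerivAt_comp_extChartAt_one_symm (A.mdifferentiableAt_left y.2) (h4 y.2)
      x.1).add ((hasDerivAt_id (0 : ℝ)).smul_const (A.infRight x.2 y.1))
    rw [one_smul] at h8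
    exact h8.deriv

/-- The bracket of `𝔤 ⋈ V` is the bracket of the Lie group `G ⋈ V`. -/
lemma CommutingReps.mulBracket_bowtie [LieGroup 𝓘(ℝ, E) ∞ G] (x y : E × V) :
    mulBracket (𝓘(ℝ, E).prod 𝓘(ℝ, V)) (Bowtie A) x y = A.bowtieBracket x y := by
  rw [mulBracket, Bowtie.mulHessian_eq, Bowtie.mulHessian_eq, CommutingReps.bowtieBracket,
    lieBr_eq_mulBracket, mulBracket]
  rfl

end BowtieBracket

/-! ### The reduced variational principle -/

section ReducedPrinciple

variable {F : Type*} [NormedAddCommGroup F] [NormedSpace ℝ F]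

/-- `Ξ` is a smooth family of curves based at `ξ`, with variation `η̇ - b ξ η` for a curve `η`
vanishing at the endpoints. -/
structure IsConstrainedVariation (b : F →L[ℝ] F →L[ℝ] F) (t₀ t₁ : ℝ) (ξ η : ℝ → F)
    (Ξ : ℝ → ℝ → F) : Prop where
  smooth_eta : ∀ t ∈ Icc t₀ t₁, ContDiffAt ℝ ∞ η t
  left : η t₀ = 0
  right : η t₁ = 0
  smooth : ∀ t ∈ Icc t₀ t₁, ContDiffAt ℝ ∞ (fun p : ℝ × ℝ => Ξ p.1 p.2) (0, t)
  base : ∀ t ∈ Icc t₀ t₁, Ξ 0 t = ξ t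
  hasDerivAt : ∀ t ∈ Icc t₀ t₁, HasDerivAt (fun ε => Ξ ε t) (deriv η t - b (ξ t) (η t)) 0

/-- The Euler–Poincaré expression `d/dt (δℓ/δξ) + ad*_ξ (δℓ/δξ)` for the bracket `b`. -/
def eulerPoincareForm (b : F →L[ℝ] F →L[ℝ] F) (ℓ : F → ℝ) (ξ : ℝ → F) (t : ℝ) : F →L[ℝ] ℝ :=
  deriv (fun s => fderiv ℝ ℓ (ξ s)) t + (fderiv ℝ ℓ (ξ t)).comp (b (ξ t))

lemma ContDiffAt.continuousAt_deriv {f : ℝ → F} {t : ℝ} (hf : ContDiffAt ℝ ∞ f t) :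
    ContinuousAt (deriv f) t := by
  have h : ContinuousAt (fun s => fderiv ℝ f s 1) t :=
    (hf.fderiv_right (m := ∞) (by simp)).continuousAt.clm_apply continuousAt_const
  simpa only [fderiv_apply_one_eq_deriv] using h

lemma ContDiffAt.deriv_right {f : ℝ → F} {t : ℝ} (hf : ContDiffAt ℝ ∞ f t) :
    ContDiffAt ℝ ∞ (deriv f) t := by
  have h : ContDiffAt ℝ ∞ (fun s => fderiv ℝ f s 1) t :=
    (hf.fderiv_right (m := ∞) (by simp)).clm_apply contDiffAt_const
  simpa only [fderiv_apply_one_eq_deriv] using h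

variable {b : F →L[ℝ] F →L[ℝ] F} {ℓ : F → ℝ} {t₀ t₁ : ℝ} {ξ : ℝ → F}

lemma contDiffAt_momentum (hℓ : ContDiff ℝ ∞ ℓ) {t : ℝ} (hξ : ContDiffAt ℝ ∞ ξ t) :
    ContDiffAt ℝ ∞ (fun s => fderiv ℝ ℓ (ξ s)) t :=
  (hℓ.fderiv_right (m := ∞) (by simp)).contDiffAt.comp t hξ

lemma continuousAt_eulerPoincareForm (hℓ : ContDiff ℝ ∞ ℓ) {t : ℝ} (hξ : ContDiffAt ℝ ∞ ξ t) :
    ContinuousAt (eulerPoincareForm b ℓ ξ) t :=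
  (contDiffAt_momentum hℓ hξ).continuousAt_deriv.add
    ((contDiffAt_momentum hℓ hξ).continuousAt.clm_comp
      (b.continuous.continuousAt.comp hξ.continuousAt))

/-- The first variation of the reduced action. -/
lemma IsConstrainedVariation.hasDerivAt_integral (hℓ : ContDiff ℝ ∞ ℓ) (ht : t₀ ≤ t₁)
    (hξ : ∀ t ∈ Icc t₀ t₁, ContDiffAt ℝ ∞ ξ t) {η : ℝ → F} {Ξ : ℝ → ℝ → F}
    (h : IsConstrainedVariation b t₀ t₁ ξ η Ξ) :
    HasDerivAt (fun ε => ∫ t in t₀..t₁, ℓ (Ξ ε t))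
      (-∫ t in t₀..t₁, eulerPoincareForm b ℓ ξ t (η t)) 0 := by
  have hs : ∀ t ∈ Icc t₀ t₁, ContDiffAt ℝ ∞ (fun p : ℝ × ℝ => ℓ (Ξ p.1 p.2)) (0, t) :=
    fun t htt => hℓ.contDiffAt.comp (0, t) (h.smooth t htt)
  have h1 := hasDerivAt_integral_of_contDiffAt ht fun t htt => (hs t htt).of_le (by norm_cast)
  refine h1.congr_deriv ?_
  -- Integration by parts done pointwise: the product rule for the momentum paired with `η` isolates
  -- a total derivative, which integrates to zero because `η` vanishes at the endpoints.
  have h2 : ∀ t ∈ uIcc t₀ t₁, fderiv ℝ (fun p : ℝ × ℝ => ℓ (Ξ p.1 p.2)) (0, t) (1, 0) =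
      deriv (fun s => fderiv ℝ ℓ (ξ s) (η s)) t - eulerPoincareForm b ℓ ξ t (η t) := by
    intro t htt
    rw [uIcc_of_le ht] at htt
    have h3 : HasDerivAt (fun ε => ℓ (Ξ ε t))
        (fderiv ℝ (fun p : ℝ × ℝ => ℓ (Ξ p.1 p.2)) (0, t) (1, 0)) 0 :=
      ((hs t htt).differentiableAt (by simp)).hasFDerivAt.comp_hasDerivAt (0 : ℝ)
        (f := fun ε : ℝ => (ε, t)) ((hasDerivAt_id (0 : ℝ)).prodMk (hasDerivAt_const _ _))
    have h4 : HasDerivAt (fun ε => ℓ (Ξ ε t))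
        (fderiv ℝ ℓ (ξ t) (deriv η t - b (ξ t) (η t))) 0 := by
      rw [← h.base t htt]
      refine (hℓ.differentiable (by simp) _).hasFDerivAt.comp_hasDerivAt (0 : ℝ) ?_
      rw [h.base t htt]
      exact h.hasDerivAt t htt
    have h5 := ((contDiffAt_momentum hℓ (hξ t htt)).differentiableAt (by simp)).hasDerivAt.clm_apply
      ((h.smooth_eta t htt).differentiableAt (by simp)).hasDerivAt
    rw [h3.unique h4, h5.deriv]
    simp [eulerPoincareForm]
  have hp : ∀ t ∈ Icc t₀ t₁, ContDiffAt ℝ ∞ (fun s => fderiv ℝ ℓ (ξ s) (η s)) t := fun t htt =>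
    (contDiffAt_momentum hℓ (hξ t htt)).clm_apply (h.smooth_eta t htt)
  have hi : IntervalIntegrable (deriv fun s => fderiv ℝ ℓ (ξ s) (η s)) MeasureTheory.volume t₀ t₁ :=
    ContinuousOn.intervalIntegrable_of_Icc ht fun t htt =>
      (hp t htt).continuousAt_deriv.continuousWithinAt
  have hj : IntervalIntegrable (fun t => eulerPoincareForm b ℓ ξ t (η t))
      MeasureTheory.volume t₀ t₁ :=
    ContinuousOn.intervalIntegrable_of_Icc ht fun t htt =>
      ((continuousAt_eulerPoincareForm hℓ (hξ t htt)).clm_apply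
        (h.smooth_eta t htt).continuousAt).continuousWithinAt
  rw [intervalIntegral.integral_congr h2, intervalIntegral.integral_sub hi hj,
    intervalIntegral.integral_deriv_eq_sub (fun t htt => ?_) hi, h.left, h.right]
  · simp
  · rw [uIcc_of_le ht] at htt
    exact (hp t htt).differentiableAt (by simp)

/-- The constrained variational principle is equivalent to the Euler–Poincaré equations. -/
lemma forall_isConstrainedVariation_iff (hℓ : ContDiff ℝ ∞ ℓ) (ht : t₀ < t₁)
    (hξ : ∀ t ∈ Icc t₀ t₁, ContDiffAt ℝ ∞ ξ t) :
    (∀ η Ξ, IsConstrainedVariation b t₀ t₁ ξ η Ξ →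
      HasDerivAt (fun ε => ∫ t in t₀..t₁, ℓ (Ξ ε t)) 0 0) ↔
    ∀ t ∈ Icc t₀ t₁, eulerPoincareForm b ℓ ξ t = 0 := by
  constructor
  · intro H t htt
    ext ζ
    refine eq_zero_of_integral_contDiff_mul_eq_zero (f := fun t => eulerPoincareForm b ℓ ξ t ζ) ht
      (fun s hs => ((continuousAt_eulerPoincareForm hℓ (hξ s hs)).clm_apply
        continuousAt_const).continuousWithinAt) (fun χ hχ h0 h1 => ?_) t htt
    set η : ℝ → F := fun t => χ t • ζ with hη
    have hηs : ContDiff ℝ ∞ η := hχ.smul contDiff_const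
    -- The variation forced by `η`; the family affine in `ε` with this slope realizes it.
    set δ : ℝ → F := fun t => deriv η t - b (ξ t) (η t) with hδ
    have hδs : ∀ t ∈ Icc t₀ t₁, ContDiffAt ℝ ∞ δ t := fun t htt =>
      hηs.contDiffAt.deriv_right.sub
        ((b.contDiff.contDiffAt.comp t (hξ t htt)).clm_apply hηs.contDiffAt)
    have hV : IsConstrainedVariation b t₀ t₁ ξ η (fun ε t => ξ t + ε • δ t) :=
      { smooth_eta := fun t _ => hηs.contDiffAt
        left := by simp [hη, h0]
        right := by simp [hη, h1]
        smooth := fun t htt =>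
          (ContDiffAt.comp (f := Prod.snd) ((0 : ℝ), t) (hξ t htt) contDiffAt_snd).add
            (contDiffAt_fst.smul
              (ContDiffAt.comp (f := Prod.snd) ((0 : ℝ), t) (hδs t htt) contDiffAt_snd))
        base := fun t _ => by simp
        hasDerivAt := fun t _ => by
          simpa using ((hasDerivAt_id (0 : ℝ)).smul_const (δ t)).const_add (ξ t) }
    have h2 := (H η _ hV).unique (hV.hasDerivAt_integral hℓ ht.le hξ)
    simpa [hη] using h2
  · intro H η Ξ hV
    refine (hV.hasDerivAt_integral hℓ ht.le hξ).congr_deriv ?_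
    rw [intervalIntegral.integral_congr (g := fun _ => (0 : ℝ)) fun t htt => ?_]
    · simp
    · rw [uIcc_of_le ht.le] at htt
      simp [H t htt]

end ReducedPrinciple

/-! ### Reduction of Hamilton's principle and of the Euler–Lagrange equations -/

section Reduction

variable {F : Type*} [NormedAddCommGroup F] [NormedSpace ℝ F]
  {H : Type*} [TopologicalSpace H] (I : ModelWithCorners ℝ F H)
  {K : Type*} [TopologicalSpace K] [ChartedSpace H K] [Group K]

variable (K) in
/-- `mulBracket` as a continuous bilinear map. -/
def mulBracketL : F →L[ℝ] F →L[ℝ] F :=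
  let h := (fderiv ℝ (fderiv ℝ (chartMul I K)) (idCoord I K, idCoord I K)).bilinearComp
    (ContinuousLinearMap.inl ℝ F F) (ContinuousLinearMap.inr ℝ F F)
  h - h.flip

lemma mulBracketL_apply (u w : F) : mulBracketL I K u w = mulBracket I K u w := rfl

lemma action_eq_reducedAction {L : TangentBundle I K → ℝ} (hinv : RightInvariant I L)
    (t₀ t₁ : ℝ) (c : ℝ → K) :
    action I L t₀ t₁ c = ∫ t in t₀..t₁, reducedLagrangian I L (rightTrivializedVelocity I c t) :=
  intervalIntegral.integral_congr fun _ _ => hinv.eq_reducedLagrangian I _ _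

lemma contDiff_reducedLagrangian {L : TangentBundle I K → ℝ} [IsManifold I 1 K]
    (hL : ContMDiff I.tangent 𝓘(ℝ, ℝ) ∞ L) : ContDiff ℝ ∞ (reducedLagrangian I L) := by
  rw [← contMDiff_iff_contDiff]
  have h : ContMDiff 𝓘(ℝ, F) I.tangent ∞
      (fun ξ : F => (⟨1, ξ⟩ : TangentBundle I K)) := by
    intro ξ
    rw [Bundle.contMDiffAt_totalSpace]
    refine ⟨contMDiffAt_const, ?_⟩
    -- On the fibre over its own base point the tangent trivialization is the identity.
    have h2 : (fun ξ : F => (trivializationAt F (TangentSpace I) (1 : K)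
        (⟨1, ξ⟩ : TangentBundle I K)).2) = id := by
      funext ξ
      exact (tangentBundleCore I K).coordChange_self (achart H 1) 1 (mem_chart_source H 1) ξ
    exact (contMDiffAt_id (x := ξ)).congr_of_eventuallyEq (Filter.EventuallyEq.of_eq h2)
  exact hL.comp h

variable [LieGroup I ∞ K]

/-- A variation matches `c` only on the closed interval, hence on one side at an endpoint.
Differentiability reduces both velocities to derivatives within the interval, where `t₀ < t₁` gives
uniqueness. -/
lemma rightTrivializedVelocity_eq_of_eqOn {c c' : ℝ → K} {t₀ t₁ t : ℝ} (ht : t₀ < t₁)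
    (htt : t ∈ Icc t₀ t₁) (hc : MDifferentiableAt 𝓘(ℝ, ℝ) I c t)
    (hc' : MDifferentiableAt 𝓘(ℝ, ℝ) I c' t) (h : EqOn c c' (Icc t₀ t₁)) :
    rightTrivializedVelocity I c t = rightTrivializedVelocity I c' t := by
  have hd : ∀ {c : ℝ → K}, MDifferentiableAt 𝓘(ℝ, ℝ) I c t →
      DifferentiableAt ℝ (fun s => extChartAt I (1 : K) (c s * (c t)⁻¹)) t := fun {c} hc => by
    rw [← mdifferentiableAt_iff_differentiableAt]
    have h1 : MDifferentiableAt I I (fun y => y * (c t)⁻¹) (c t) :=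
      (contMDiff_mul_right (I := I) (n := ∞)).mdifferentiableAt (by simp)
    exact ((contMDiffAt_extChartAt_one I (mul_inv_cancel (c t))).mdifferentiableAt
      (by simp)).comp t (h1.comp t hc)
  have hu : UniqueDiffWithinAt ℝ (Icc t₀ t₁) t := uniqueDiffOn_Icc ht t htt
  rw [rightTrivializedVelocity_eq_deriv I hc, rightTrivializedVelocity_eq_deriv I hc',
    ← (hd hc).derivWithin hu, ← (hd hc').derivWithin hu]
  refine derivWithin_congr (fun s hs => ?_) ?_
  · rw [h hs, h htt]
  · rw [h htt]

variable [I.Boundaryless]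

lemma contDiffAt_rightTrivializedVelocity {c : ℝ → K} {t : ℝ}
    (hc : ContMDiffAt 𝓘(ℝ, ℝ) I ∞ c t) : ContDiffAt ℝ ∞ (rightTrivializedVelocity I c) t := by
  have h := (rightTrivializedVelocity_variation I (γ := fun _ => c) (t := t)
    (hc.comp (f := Prod.snd) ((0 : ℝ), t) contDiff_snd.contMDiff.contMDiffAt)).1
  exact ContDiffAt.comp (f := fun s : ℝ => ((0 : ℝ), s)) t h (contDiffAt_const.prodMk contDiffAt_id)

/-- A variation with fixed endpoints induces a constrained variation of the right-trivialized
velocity. -/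
lemma IsFixedEndpointVariation.isConstrainedVariation {t₀ t₁ : ℝ} (ht : t₀ < t₁) {c : ℝ → K}
    (hc : ∀ t ∈ Icc t₀ t₁, ContMDiffAt 𝓘(ℝ, ℝ) I ∞ c t) {γ : ℝ → ℝ → K}
    (hγ : IsFixedEndpointVariation I t₀ t₁ c γ) :
    IsConstrainedVariation (mulBracketL I K) t₀ t₁ (rightTrivializedVelocity I c)
      (fun t => rightTrivializedVelocity I (fun ε => γ ε t) 0)
      (fun ε t => rightTrivializedVelocity I (γ ε) t) := by
  have hbase : ∀ t ∈ Icc t₀ t₁,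
      rightTrivializedVelocity I (γ 0) t = rightTrivializedVelocity I c t := fun t htt =>
    rightTrivializedVelocity_eq_of_eqOn I ht htt
      (((hγ.smooth t htt).mdifferentiableAt (by simp)).comp (f := fun s : ℝ => ((0 : ℝ), s)) t
        ((contDiff_prodMk_right (n := 1) (0 : ℝ)).contMDiff.mdifferentiableAt (by simp)))
      ((hc t htt).mdifferentiableAt (by simp)) hγ.base
  have hzero : ∀ t ∈ Icc t₀ t₁, (∀ᶠ ε in 𝓝 (0 : ℝ), γ ε t = c t) →
      rightTrivializedVelocity I (fun ε => γ ε t) 0 = 0 := fun t htt h => by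
    have hcst : (fun ε => γ ε t) =ᶠ[𝓝 0] fun _ => c t := h
    have hd : MDifferentiableAt 𝓘(ℝ, ℝ) I (fun ε => γ ε t) 0 :=
      mdifferentiableAt_const.congr_of_eventuallyEq hcst
    rw [rightTrivializedVelocity_eq_deriv I hd]
    have hcst' : (fun s => extChartAt I (1 : K) (γ s t * (γ 0 t)⁻¹)) =ᶠ[𝓝 0]
        fun _ => extChartAt I (1 : K) (c t * (γ 0 t)⁻¹) := h.mono fun s hs => by
      simp only [hs]
    rw [hcst'.deriv_eq, deriv_const]
  exact
    { smooth_eta := fun t htt => (rightTrivializedVelocity_variation I (hγ.smooth t htt)).2.1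
      left := hzero t₀ (left_mem_Icc.2 ht.le) hγ.left_fixed
      right := hzero t₁ (right_mem_Icc.2 ht.le) hγ.right_fixed
      smooth := fun t htt => (rightTrivializedVelocity_variation I (hγ.smooth t htt)).1
      base := hbase
      hasDerivAt := fun t htt => by
        rw [← hbase t htt]
        exact (rightTrivializedVelocity_variation I (hγ.smooth t htt)).2.2 }

/-- Every curve `η` in the Lie algebra vanishing at the endpoints comes from a variation with fixed
endpoints. -/
lemma exists_isFixedEndpointVariation {t₀ t₁ : ℝ} {c : ℝ → K}
    (hc : ∀ t ∈ Icc t₀ t₁, ContMDiffAt 𝓘(ℝ, ℝ) I ∞ c t) {η : ℝ → F}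
    (hη : ∀ t ∈ Icc t₀ t₁, ContDiffAt ℝ ∞ η t) (h0 : η t₀ = 0) (h1 : η t₁ = 0) :
    ∃ γ : ℝ → ℝ → K, IsFixedEndpointVariation I t₀ t₁ c γ ∧
      ∀ t, rightTrivializedVelocity I (fun ε => γ ε t) 0 = η t := by
  -- A coordinate ray from the identity in direction `η` replaces the exponential; only its
  -- first-order behaviour at `ε = 0` matters.
  refine ⟨fun ε t => (extChartAt I (1 : K)).symm (idCoord I K + ε • η t) * c t,
    ⟨fun t htt => ?_, fun t _ => ?_, ?_, ?_⟩, fun t => ?_⟩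
  · have h2 : ContDiffAt ℝ ∞ (fun p : ℝ × ℝ => idCoord I K + p.1 • η p.2) (0, t) :=
      contDiffAt_const.add (contDiffAt_fst.smul
        (ContDiffAt.comp (f := Prod.snd) ((0 : ℝ), t) (hη t htt) contDiffAt_snd))
    have h3 : ContMDiffAt 𝓘(ℝ, F) I ∞ (extChartAt I (1 : K)).symm
        (idCoord I K + ((0 : ℝ), t).1 • η ((0 : ℝ), t).2) := by
      simpa only [zero_smul, add_zero] using contMDiffAt_extChartAt_one_symm (K := K) I
    exact (h3.comp ((0 : ℝ), t) h2.contMDiffAt).mul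
      ((hc t htt).comp (f := Prod.snd) ((0 : ℝ), t) contDiff_snd.contMDiff.contMDiffAt)
  · simp only [zero_smul, add_zero, extChartAt_one_symm_idCoord, one_mul]
  · exact Filter.Eventually.of_forall fun ε => by
      simp only [h0, smul_zero, add_zero, extChartAt_one_symm_idCoord, one_mul]
  · exact Filter.Eventually.of_forall fun ε => by
      simp only [h1, smul_zero, add_zero, extChartAt_one_symm_idCoord, one_mul]
  · have hl : HasDerivAt (fun ε : ℝ => idCoord I K + ε • η t) (η t) 0 := by
      simpa using ((hasDerivAt_id (0 : ℝ)).smul_const (η t)).const_add (idCoord I K)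
    have hl0 : idCoord I K + (0 : ℝ) • η t = idCoord I K := by simp
    have h3 : ContMDiffAt 𝓘(ℝ, F) I ∞ (extChartAt I (1 : K)).symm
        (idCoord I K + (0 : ℝ) • η t) := by
      rw [hl0]; exact contMDiffAt_extChartAt_one_symm (K := K) I
    have hl2 : ContDiff ℝ ∞ (fun ε : ℝ => idCoord I K + ε • η t) := by fun_prop
    have hd : MDifferentiableAt 𝓘(ℝ, ℝ) I
        (fun ε : ℝ => (extChartAt I (1 : K)).symm (idCoord I K + ε • η t) * c t) 0 :=
      ((h3.comp (0 : ℝ) hl2.contMDiff.contMDiffAt).mul contMDiffAt_const).mdifferentiableAt (by simp)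
    rw [rightTrivializedVelocity_eq_deriv I hd]
    have hc : Filter.Tendsto (fun ε : ℝ => idCoord I K + ε • η t) (𝓝 0) (𝓝 (idCoord I K)) := by
      simpa using hl.continuousAt.tendsto
    have hev : (fun s : ℝ => extChartAt I (1 : K)
        ((extChartAt I (1 : K)).symm (idCoord I K + s • η t) * c t *
          ((extChartAt I (1 : K)).symm (idCoord I K + (0 : ℝ) • η t) * c t)⁻¹)) =ᶠ[𝓝 0]
        fun ε => idCoord I K + ε • η t := by
      filter_upwards [hc.eventually (eventually_extChartAt_one (K := K) I)] with s hs
      rw [hl0, extChartAt_one_symm_idCoord, one_mul, mul_inv_cancel_right, hs]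
    rw [hev.deriv_eq, hl.deriv]

/-- Hamilton's principle for a right-invariant Lagrangian is the reduced constrained variational
principle. -/
lemma hamiltonPrinciple_iff_reduced {L : TangentBundle I K → ℝ}
    (hℓ : ContDiff ℝ ∞ (reducedLagrangian I L)) (hinv : RightInvariant I L) {t₀ t₁ : ℝ}
    (ht : t₀ < t₁) {c : ℝ → K} (hc : ∀ t ∈ Icc t₀ t₁, ContMDiffAt 𝓘(ℝ, ℝ) I ∞ c t) :
    HamiltonPrinciple I L t₀ t₁ c ↔
      ∀ η Ξ, IsConstrainedVariation (mulBracketL I K) t₀ t₁ (rightTrivializedVelocity I c) η Ξ →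
        HasDerivAt (fun ε => ∫ t in t₀..t₁, reducedLagrangian I L (Ξ ε t)) 0 0 := by
  have hξ : ∀ t ∈ Icc t₀ t₁, ContDiffAt ℝ ∞ (rightTrivializedVelocity I c) t := fun t htt =>
    contDiffAt_rightTrivializedVelocity I (hc t htt)
  constructor
  · intro h η Ξ hV
    obtain ⟨γ, hγ, hγη⟩ := exists_isFixedEndpointVariation I hc hV.smooth_eta hV.left hV.right
    have h1 := h γ hγ
    simp only [action_eq_reducedAction I hinv] at h1
    have hW := hγ.isConstrainedVariation I ht hc
    simp only [hγη] at hW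
    -- Both families share `η`, and the first variation sees nothing else, so stationarity passes
    -- from the family induced by `γ` to the arbitrary `Ξ`.
    have h2 := h1.unique (hW.hasDerivAt_integral hℓ ht.le hξ)
    exact (hV.hasDerivAt_integral hℓ ht.le hξ).congr_deriv h2.symm
  · intro h γ hγ
    simp only [action_eq_reducedAction I hinv]
    exact h _ _ (hγ.isConstrainedVariation I ht hc)

/-- The Euler–Lagrange equation in a chart is the Euler–Poincaré equation tested on the image of
the right trivialization of the chart. -/
lemma hasDerivAt_localLagrangian_iff {L : TangentBundle I K → ℝ}
    (hℓ : ContDiff ℝ ∞ (reducedLagrangian I L)) (hinv : RightInvariant I L) {c : ℝ → K} {t : ℝ}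
    (hc : ContMDiffAt 𝓘(ℝ, ℝ) I ∞ c t) {e : OpenPartialHomeomorph K H}
    (he : e ∈ IsManifold.maximalAtlas I ∞ K) (hs : c t ∈ e.source) {q : ℝ → F}
    (hq : q = fun s => e.extend I (c s)) :
    HasDerivAt (fun s => fderiv ℝ (fun w => localLagrangian I L e (q s) w) (deriv q s))
      (fderiv ℝ (fun x => localLagrangian I L e x (deriv q t)) (q t)) t ↔
    (eulerPoincareForm (mulBracketL I K) (reducedLagrangian I L)
      (rightTrivializedVelocity I c) t).comp (chartTriv I e (q t)) = 0 := by
  have hqt : q t ∈ (e.extend I).target := by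
    rw [hq]; exact (e.extend I).map_source (by rwa [e.extend_source])
  have hqs : ContDiffAt ℝ ∞ q t := by
    rw [← contMDiffAt_iff_contDiffAt, hq]
    exact (e.contMDiffAt_extend he hs).comp t hc
  have : IsManifold I 1 K := IsManifold.of_le (n := ∞) (by norm_cast)
  have hcd : ∀ᶠ s in 𝓝 t, MDifferentiableAt 𝓘(ℝ, ℝ) I c s :=
    ((contMDiffAt_iff_contMDiffAt_nhds (n := 1) (by simp)).1
      (hc.of_le (by norm_cast))).mono fun p hp => hp.mdifferentiableAt (by simp)
  have hRs := contDiffAt_chartTriv I he hqt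
  have hξ : ∀ᶠ s in 𝓝 t,
      rightTrivializedVelocity I c s = chartTriv I e (q s) (deriv q s) := by
    filter_upwards [hcd, hc.continuousAt.eventually (e.open_source.mem_nhds hs)] with s h1 h2
    rw [hq]; exact rightTrivializedVelocity_eq_chartTriv I he h1 h2
  -- The chart momentum is the reduced momentum pulled back by `chartTriv`.
  have hp : (fun s => fderiv ℝ (fun w => localLagrangian I L e (q s) w) (deriv q s)) =ᶠ[𝓝 t]
      fun s => (fderiv ℝ (reducedLagrangian I L) (rightTrivializedVelocity I c s)).comp
        (chartTriv I e (q s)) := by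
    filter_upwards [hξ, hqs.continuousAt.eventually (e.isOpen_extend_target.mem_nhds hqt)]
      with s h1 h2
    simp only [localLagrangian_eq I he hinv h2]
    rw [h1]
    exact (((hℓ.differentiable (by simp) _).hasFDerivAt).comp (deriv q s)
      (chartTriv I e (q s)).hasFDerivAt).fderiv
  have hx : fderiv ℝ (fun x => localLagrangian I L e x (deriv q t)) (q t) =
      (fderiv ℝ (reducedLagrangian I L) (rightTrivializedVelocity I c t)).comp
        ((fderiv ℝ (chartTriv I e) (q t)).flip (deriv q t)) := by
    have h1 : (fun x => localLagrangian I L e x (deriv q t)) =ᶠ[𝓝 (q t)]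
        fun x => reducedLagrangian I L (chartTriv I e x (deriv q t)) := by
      filter_upwards [e.isOpen_extend_target.mem_nhds hqt] with x hx
      exact localLagrangian_eq I he hinv hx _
    rw [h1.fderiv_eq, hξ.self_of_nhds]
    have h2 := (hRs.differentiableAt (by simp)).hasFDerivAt.clm_apply
      (hasFDerivAt_const (deriv q t) (q t))
    rw [ContinuousLinearMap.comp_zero, zero_add] at h2
    exact ((hℓ.differentiable (by simp) _).hasFDerivAt.comp (q t) h2).fderiv
  have hd := ((contDiffAt_momentum hℓ (contDiffAt_rightTrivializedVelocity I hc)).differentiableAt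
    (by simp)).hasDerivAt.clm_comp ((hRs.differentiableAt (by simp)).hasFDerivAt.comp_hasDerivAt t
      (hqs.differentiableAt (by simp)).hasDerivAt)
  have hd' := hd.congr_of_eventuallyEq hp
  -- The time derivative of the momentum contributes `dR(q̇) u` and the `q`-derivative of the
  -- Lagrangian `dR(u) q̇`; their difference is the bracket with `ξ`.
  have hMC := fderiv_chartTriv_sub I he hqt (deriv q t)
  have key : ∀ X : F →L[ℝ] ℝ, HasDerivAt
      (fun s => fderiv ℝ (fun w => localLagrangian I L e (q s) w) (deriv q s)) X t ↔
      (deriv (fun s => fderiv ℝ (reducedLagrangian I L) (rightTrivializedVelocity I c s)) t).comp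
        (chartTriv I e (q t)) + (fderiv ℝ (reducedLagrangian I L)
          (rightTrivializedVelocity I c t)).comp
        (fderiv ℝ (chartTriv I e) (q t) (deriv q t)) = X :=
    fun X => ⟨fun h => hd'.unique h, fun h => hd'.congr_deriv h⟩
  rw [key, hx, ← sub_eq_zero]
  refine Eq.congr_left ?_
  ext u
  simp only [eulerPoincareForm, ContinuousLinearMap.comp_apply, add_apply,
    sub_apply, ContinuousLinearMap.flip_apply, mulBracketL_apply]
  rw [hξ.self_of_nhds, ← hMC u, map_sub]
  abel

/-- The Euler–Lagrange equations for a right-invariant Lagrangian are the Euler–Poincaré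
equations. -/
lemma eulerLagrange_iff_eulerPoincareForm {L : TangentBundle I K → ℝ}
    (hℓ : ContDiff ℝ ∞ (reducedLagrangian I L)) (hinv : RightInvariant I L) {t₀ t₁ : ℝ}
    {c : ℝ → K} (hc : ∀ t ∈ Icc t₀ t₁, ContMDiffAt 𝓘(ℝ, ℝ) I ∞ c t) :
    EulerLagrange I L t₀ t₁ c ↔
      ∀ t ∈ Icc t₀ t₁, eulerPoincareForm (mulBracketL I K) (reducedLagrangian I L)
        (rightTrivializedVelocity I c) t = 0 := by
  constructor
  · intro h t htt
    have he : chartAt H (c t) ∈ IsManifold.maximalAtlas I ∞ K := IsManifold.chart_mem_maximalAtlas _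
    have hs : c t ∈ (chartAt H (c t)).source := mem_chart_source H _
    have h1 := (hasDerivAt_localLagrangian_iff I hℓ hinv (hc t htt) he hs rfl).1 (h t htt _ he hs)
    ext ζ
    -- One chart suffices: every Lie algebra direction is the trivialization of some coordinate
    -- direction.
    obtain ⟨u, rfl⟩ := chartTriv_surjective I he (q := (chartAt H (c t)).extend I (c t))
      (((chartAt H (c t)).extend I).map_source (by rwa [OpenPartialHomeomorph.extend_source])) ζ
    exact congrArg (fun l => l u) h1
  · intro h t htt e he hs
    exact (hasDerivAt_localLagrangian_iff I hℓ hinv (hc t htt) he hs rfl).2 (by simp [h t htt])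

end Reduction

section Main

variable {E G V : Type*} [NormedAddCommGroup E] [NormedSpace ℝ E]
  [TopologicalSpace G] [ChartedSpace E G] [Group G] [LieGroup 𝓘(ℝ, E) ∞ G]
  [NormedAddCommGroup V] [NormedSpace ℝ V]

lemma CommutingReps.reducedVariationalPrinciple_iff (A : CommutingReps E G V) (ℓ : E × V → ℝ)
    (t₀ t₁ : ℝ) (ξ : ℝ → E × V) :
    A.ReducedVariationalPrinciple ℓ t₀ t₁ ξ ↔
      ∀ η Ξ, IsConstrainedVariation (mulBracketL (𝓘(ℝ, E).prod 𝓘(ℝ, V)) (Bowtie A)) t₀ t₁ ξ η Ξ →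
        HasDerivAt (fun ε => ∫ t in t₀..t₁, ℓ (Ξ ε t)) 0 0 := by
  refine forall₂_congr fun η Ξ => ?_
  simp only [← A.mulBracket_bowtie]
  exact ⟨fun h hV => h hV.smooth_eta hV.left hV.right hV.smooth hV.base hV.hasDerivAt,
    fun h h1 h2 h3 h4 h5 h6 => h ⟨h1, h2, h3, h4, h5, h6⟩⟩

/-- The components of the Euler–Poincaré equations on `𝔤 ⋈ V`. -/
lemma CommutingReps.eulerPoincare_iff [FiniteDimensional ℝ E] [FiniteDimensional ℝ V]
    (A : CommutingReps E G V) {ℓ : E × V → ℝ}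
    (hℓ : ContDiff ℝ ∞ ℓ) {t₀ t₁ : ℝ} {ξ : ℝ → E × V}
    (hξ : ∀ t ∈ Icc t₀ t₁, ContDiffAt ℝ ∞ ξ t) :
    A.EulerPoincare ℓ t₀ t₁ ξ ↔ ∀ t ∈ Icc t₀ t₁,
      eulerPoincareForm (mulBracketL (𝓘(ℝ, E).prod 𝓘(ℝ, V)) (Bowtie A)) ℓ ξ t = 0 := by
  have hG : ∀ x, partialG ℓ x = (fderiv ℝ ℓ x).comp (ContinuousLinearMap.inl ℝ E V) := fun x =>
    ((hℓ.differentiable (by simp) x).hasFDerivAt.comp x.1 (f := fun ζ : E => (ζ, x.2))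
      ((hasFDerivAt_id _).prodMk (hasFDerivAt_const _ _))).fderiv
  have hV : ∀ x, partialV ℓ x = (fderiv ℝ ℓ x).comp (ContinuousLinearMap.inr ℝ E V) := fun x =>
    ((hℓ.differentiable (by simp) x).hasFDerivAt.comp x.2 (f := fun w : V => (x.1, w))
      ((hasFDerivAt_const _ _).prodMk (hasFDerivAt_id _))).fderiv
  refine forall₂_congr fun t htt => ?_
  have hμ := ((contDiffAt_momentum hℓ (hξ t htt)).differentiableAt (by simp)).hasDerivAt
  have hμG := hμ.clm_comp (hasDerivAt_const t (ContinuousLinearMap.inl ℝ E V))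
  have hμV := hμ.clm_comp (hasDerivAt_const t (ContinuousLinearMap.inr ℝ E V))
  simp only [ContinuousLinearMap.comp_zero, add_zero] at hμG hμV
  have hlie : ∀ x y : E, lieBr G x y = adMap G x y := fun _ _ => rfl
  have hdec : ∀ ζ : E × V,
      eulerPoincareForm (mulBracketL (𝓘(ℝ, E).prod 𝓘(ℝ, V)) (Bowtie A)) ℓ ξ t ζ =
      (deriv (fun s => partialG ℓ (ξ s)) t + coad G (ξ t).1 (partialG ℓ (ξ t))
        + A.diamond (ξ t).2 (partialV ℓ (ξ t))) ζ.1 +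
      (deriv (fun s => partialV ℓ (ξ s)) t + A.heart (ξ t).1 (partialV ℓ (ξ t))) ζ.2 := by
    intro ζ
    simp only [hG, hV]
    rw [hμG.deriv, hμV.deriv]
    have hsplit : ∀ (l : E × V →L[ℝ] ℝ) (x : E) (v : V), l (x, v) = l (x, 0) + l (0, v) :=
      fun l x v => by rw [← map_add]; simp
    simp only [eulerPoincareForm, add_apply, ContinuousLinearMap.comp_apply, mulBracketL_apply,
      A.mulBracket_bowtie, CommutingReps.bowtieBracket, coad, CommutingReps.diamond,
      CommutingReps.heart, ContinuousLinearMap.inl_apply, ContinuousLinearMap.inr_apply,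
      LinearMap.coe_toContinuousLinearMap', hlie, sub_apply]
    have hdiff : A.infDiff (ξ t).1 ζ.2 = A.infLeft ζ.2 (ξ t).1 - A.infRight ζ.2 (ξ t).1 := rfl
    rw [hdiff, hsplit _ (adMap G (ξ t).1 ζ.1), ← Prod.mk.eta (p := ζ), hsplit _ ζ.1 ζ.2]
    -- The `V`-part of the bracket regrouped by test component: the terms in `ζ.1` make the diamond,
    -- those in `ζ.2` the heart.
    have hsum : (A.infLeft ζ.2 (ξ t).1 + A.infRight (ξ t).2 ζ.1 -
        (A.infLeft (ξ t).2 ζ.1 + A.infRight ζ.2 (ξ t).1)) =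
        (A.infRight (ξ t).2 ζ.1 - A.infLeft (ξ t).2 ζ.1) +
        (A.infLeft ζ.2 (ξ t).1 - A.infRight ζ.2 (ξ t).1) := by abel
    rw [hsum]
    have hadd : ∀ (l : E × V →L[ℝ] ℝ) (v w : V), l (0, v + w) = l (0, v) + l (0, w) :=
      fun l v w => by rw [← map_add]; simp
    rw [hadd]
    ring
  constructor
  -- Differentiability of the momenta is discarded here: it is automatic, as `ξ` and `ℓ` are smooth.
  · rintro ⟨-, -, h1, h2⟩
    ext ζ
    · rw [ContinuousLinearMap.comp_apply, hdec, h1, h2]; simp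
    · rw [ContinuousLinearMap.comp_apply, hdec, h1, h2]; simp
  · intro h
    refine ⟨?_, ?_, ?_, ?_⟩
    · simp only [hG]; exact hμG.differentiableAt
    · simp only [hV]; exact hμV.differentiableAt
    · ext x
      have h1 := hdec (x, 0)
      rw [h, map_zero, add_zero] at h1
      exact h1.symm
    · ext v
      have h1 := hdec (0, v)
      rw [h, map_zero, zero_add] at h1
      exact h1.symm

end Main

end

theorem mainTheorem1 {E G V : Type*}
    [NormedAddCommGroup E] [NormedSpace ℝ E] [FiniteDimensional ℝ E]
    [TopologicalSpace G] [ChartedSpace E G] [Group G] [LieGroup 𝓘(ℝ, E) ∞ G]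
    [NormedAddCommGroup V] [NormedSpace ℝ V] [FiniteDimensional ℝ V]
    (A : CommutingReps E G V)
    (L : TangentBundle (𝓘(ℝ, E).prod 𝓘(ℝ, V)) (Bowtie A) → ℝ)
    (hL : ContMDiff (𝓘(ℝ, E).prod 𝓘(ℝ, V)).tangent 𝓘(ℝ, ℝ) ∞ L)
    (hinv : RightInvariant (𝓘(ℝ, E).prod 𝓘(ℝ, V)) L)
    (t₀ t₁ : ℝ) (ht : t₀ < t₁)
    (c : ℝ → Bowtie A)
    (hc : ∀ t ∈ Set.Icc t₀ t₁, ContMDiffAt 𝓘(ℝ, ℝ) (𝓘(ℝ, E).prod 𝓘(ℝ, V)) ∞ c t) :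
    let ℓ : E × V → ℝ := reducedLagrangian (𝓘(ℝ, E).prod 𝓘(ℝ, V)) L
    let ξ : ℝ → E × V := rightTrivializedVelocity (𝓘(ℝ, E).prod 𝓘(ℝ, V)) c
    List.TFAE
      [HamiltonPrinciple (𝓘(ℝ, E).prod 𝓘(ℝ, V)) L t₀ t₁ c,
       EulerLagrange (𝓘(ℝ, E).prod 𝓘(ℝ, V)) L t₀ t₁ c,
       A.ReducedVariationalPrinciple ℓ t₀ t₁ ξ,
       A.EulerPoincare ℓ t₀ t₁ ξ] := by
  intro ℓ ξ
  have hM : IsManifold (𝓘(ℝ, E).prod 𝓘(ℝ, V)) 1 (Bowtie A) :=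
    IsManifold.of_le (n := ∞) (by norm_cast)
  have hℓ : ContDiff ℝ ∞ ℓ := contDiff_reducedLagrangian (𝓘(ℝ, E).prod 𝓘(ℝ, V)) hL
  have hξ : ∀ t ∈ Icc t₀ t₁, ContDiffAt ℝ ∞ ξ t := fun t htt =>
    contDiffAt_rightTrivializedVelocity (𝓘(ℝ, E).prod 𝓘(ℝ, V)) (hc t htt)
  have h34 := forall_isConstrainedVariation_iff
    (b := mulBracketL (𝓘(ℝ, E).prod 𝓘(ℝ, V)) (Bowtie A)) hℓ ht hξ
  have h13 := hamiltonPrinciple_iff_reduced (𝓘(ℝ, E).prod 𝓘(ℝ, V)) hℓ hinv ht hc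
  have h24 := eulerLagrange_iff_eulerPoincareForm (𝓘(ℝ, E).prod 𝓘(ℝ, V)) hℓ hinv hc
  have h3 := A.reducedVariationalPrinciple_iff ℓ t₀ t₁ ξ
  have h4 := A.eulerPoincare_iff hℓ hξ
  tfae_have 1 ↔ 3 := h13.trans h3.symm
  tfae_have 2 ↔ 4 := h24.trans h4.symm
  tfae_have 3 ↔ 4 := h3.trans (h34.trans h4.symm)
  tfae_finish
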